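/- Let $A_i,V_i$ ($i\in\mathbb Z$) be indeterminates (or arbitrary non-zero elements of a field). An \emph{up-down path} has steps $(1,1)$ (up) and $(1,-1)$ (down). Let $\mathcal C_n^{(h)}(r\to s)$ be the set of up-down paths from $(0,r)$ to $(n,s)$ that pass neither below the $x$-axis nor above the line $y=h$, let $\mathcal C_n^{(h)}=\mathcal C_n^{(h)}(0\to0)$ and $\mathcal D_{t}^{(h)}=\mathcal C_{t+h}^{(h)}(0\to h)$. The weight $w_{BAV}(P)$ of a path $P$ is the product of the weights of its steps: an up-step has weight $1$, a down-step from height $2i-1$ to $2i-2$ has weight $A_i^{-1}V_i^{-1}$, and a down-step from height $2i$ to $2i-1$ has weight $A_i^{-1}V_{i+1}^{-1}$. Write $\operatorname{GF}(\mathcal O;w)=\sum_{t\in\mathcal O}w(t)$. For odd $h$ the sequence $\big(\operatorname{GF}(\mathcal C_n^{(h)}(r\to s);w_{BAV})\big)_{n\ge0}$ has a unique continuation to all integers $n$ that satisfies a linear recurrence with constant coefficients whose first and last coefficients are non-zero; for $n<0$, $\operatorname{GF}(\mathcal C_n^{(h)}(r\to s);w_{BAV})$ denotes the corresponding term of this continuation,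 and similarly for $\mathcal D$. The operator $R_{AV}^{(N)}$ replaces $A_i$ by $V_{N+1-i}$ and $V_i$ by $A_{N+1-i}$ for all $i$. Products are extended by $\prod_{i=R}^{S-1}f(i)=1$ if $R=S$ and $\prod_{i=R}^{S-1}f(i)=\prod_{i=S}^{R-1}f(i)^{-1}$ if $R>S$. Write $h=2k+2m-1$. (a) For all non-negative integers $n,k,m$, $$\det\Big(\operatorname{GF}\big(\mathcal C_{2n+2i+2j+4m-2}^{(h)};w_{BAV}\big)\Big)_{0\le i,j\le k-1}=\Big(V_1^kA_{k+m}^{-m}\prod_{i=1}^{k+m}A_i^{-(n+2m+2k-2i-1)}V_i^{-(n+2m+2k-2i)}\Big)\det\Big(R_{AV}^{(k+m)}\operatorname{GF}\big(\mathcal C_{-2n-2i-2j}^{(h)};w_{BAV}\big)\Big)_{0\le i,j\le m-1}.$$ (b) For all non-negative integers $n$ and positive integers $k,m$, $$\det\Big(\operatorname{GF}\big(\mathcal D_{2n+2j-2i}^{(h)};w_{BAV}\big)\Big)_{0\le i,j\le k-1}=(-1)^{km}\Big(\prod_{i=1}^{k+m}A_i^{-n-m}V_i^{-n-m}\Big)\det\Big(R_{AV}^{(k+m)}\operatorname{GF}\big(\mathcal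 D_{-2n-2j+2i-2k-2m}^{(h)};w_{BAV}\big)\Big)_{0\le i,j\le m-1}.$$ For (c) and (d) let $k,m$ be positive integers, let $r_0<\dots<r_{k-1}$ and $s_0<\dots<s_{k-1}$ be integers in $\{1,\dots,k+m\}$, and let $\bar r_0<\dots<\bar r_{m-1}$ and $\bar s_0<\dots<\bar s_{m-1}$ be the elements of $\{1,\dots,k+m\}\setminus\{r_0,\dots,r_{k-1}\}$ and of $\{1,\dots,k+m\}\setminus\{s_0,\dots,s_{k-1}\}$. (c) For all non-negative integers $n$, with $\Delta=\det\big(\operatorname{GF}(\mathcal C_{-2n}^{(h)}(2\bar r_i-2\to2\bar s_j-2);w_{BAV})\big)_{0\le i,j\le m-1}$, $$\det\Big(\operatorname{GF}\big(\mathcal C_{2n}^{(h)}(2r_i-2\to2s_j-2);w_{BAV}\big)\Big)_{0\le i,j\le k-1} =(-1)^{\sum_{i=0}^{k-1}(r_i+s_i)}\Big(\prod_{i=1}^{k+m}A_i^{-n}V_i^{-n}\Big)\Big(\prod_{j=0}^{k-1}V_{s_j}V_{r_j}^{-1}\prod_{i=r_j}^{s_j-1}A_i^2V_i^2\Big)\Delta$$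 $$=(-1)^{\sum_{i=0}^{m-1}(\bar r_i+\bar s_i)}\Big(\prod_{i=1}^{k+m}A_i^{-n}V_i^{-n}\Big)\Big(\prod_{j=0}^{m-1}V_{\bar r_j}V_{\bar s_j}^{-1}\prod_{i=\bar r_j}^{\bar s_j-1}A_i^{-2}V_i^{-2}\Big)\Delta.$$ (d) For all positive integers $n$, with $\Delta'=\det\big(\operatorname{GF}(\mathcal C_{-2n+1}^{(h)}(2\bar r_i-2\to2\bar s_j-1);w_{BAV})\big)_{0\le i,j\le m-1}$, $$\det\Big(\operatorname{GF}\big(\mathcal C_{2n-1}^{(h)}(2r_i-2\to2s_j-1);w_{BAV}\big)\Big)_{0\le i,j\le k-1} =(-1)^{\sum_{i=0}^{k-1}(r_i+s_i)}\Big(\prod_{i=1}^{k+m}A_i^{-n}V_i^{-n}\Big)\Big(\prod_{j=0}^{k-1}A_{r_j}^2V_{r_j}A_{s_j}^{-1}\prod_{i=r_j+1}^{s_j}A_i^2V_i^2\Big)\Delta'$$ $$=(-1)^{\sum_{i=0}^{m-1}(\bar r_i+\bar s_i)}\Big(\prod_{i=1}^{k+m}A_i^{-n+1}V_i^{-n+1}\Big)\Big(\prod_{j=0}^{m-1}A_{\bar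 r_j}^{-2}V_{\bar r_j}^{-1}A_{\bar s_j}\prod_{i=\bar r_j+1}^{\bar s_j}A_i^{-2}V_i^{-2}\Big)\Delta'.$$ (e) Let $q$ be an indeterminate (or a non-zero element of a field). For a path $P$ in $\mathcal C_n^{(h)}$ let $a(P)$ be its area, that is, the number of full squares (with vertices $(x,b),(x\pm1,b+1),(x,b+2)$) that fit between $P$ and the zigzag path $(0,0),(1,1),(2,0),(3,1),\dots$. For the weights $q^{a(\cdot)}$ and $q^{-a(\cdot)}$ the continuation to negative lengths again exists and is unique, and for all non-negative integers $n,k,m$, $$\det\Big(\operatorname{GF}\big(\mathcal C_{2n+2i+2j+4m-2}^{(h)};q^{a(\cdot)}\big)\Big)_{0\le i,j\le k-1}=q^{2\binom k2\left(\frac{4k+1}6+n+2m-2\right)-2\binom m2\left(n-1+\frac{8m-1}6\right)}\det\Big(\operatorname{GF}\big(\mathcal C_{-2n-2i-2j}^{(h)};q^{-a(\cdot)}\big)\Big)_{0\le i,j\le m-1},$$ where the exponent of $q$ is an integer. -/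

import Mathlib

namespace PathReciprocity

/-- The up-down paths (steps `(1,1)` and `(1,-1)`) from `(0,r)` to `(n,s)` that do not pass below
the `x`-axis and not above the line `y = h`.  A path is given by its heights at `0, 1, …, n`. -/
noncomputable def upDownPaths (h : ℤ) (n : ℕ) (r s : ℤ) : Finset (Fin (n + 1) → ℤ) :=
  {p ∈ Fintype.piFinset (fun _ : Fin (n + 1) => Finset.Icc 0 h) |
    p 0 = r ∧ p (Fin.last n) = s ∧
      ∀ i : Fin n, p i.succ = p i.castSucc + 1 ∨ p i.succ = p i.castSucc - 1}

/-- The generating function `∑_{t ∈ O} w(t)`. -/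
def GF {K : Type*} [Field K] {α : Type*} (O : Finset α) (w : α → K) : K := ∑ t ∈ O, w t

/-- The weight `w_B`: an up-step has weight `1`, a down-step from height `h` to height `h - 1` has
weight `B h`, and a path has the product of the weights of its steps. -/
def wB {K : Type*} [Field K] (B : ℤ → K) (n : ℕ) (p : Fin (n + 1) → ℤ) : K :=
  ∏ i : Fin n, if p i.succ = p i.castSucc - 1 then B (p i.castSucc) else 1

/-- The substitution `B_{2i-1} = A_i⁻¹ V_i⁻¹`, `B_{2i} = A_i⁻¹ V_{i+1}⁻¹`. -/
def substAV {K : Type*} [Field K] (A V : ℤ → K) (h : ℤ) : K :=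
  if Odd h then (A ((h + 1) / 2))⁻¹ * (V ((h + 1) / 2))⁻¹
  else (A (h / 2))⁻¹ * (V (h / 2 + 1))⁻¹

/-- The weight `w_{BAV}` of up-down paths. -/
def wBAV {K : Type*} [Field K] (A V : ℤ → K) (n : ℕ) (p : Fin (n + 1) → ℤ) : K :=
  wB (substAV A V) n p

/-- `f` continues the sequence `u` to all integers by a linear recurrence with constant
coefficients `c 0, …, c d` that can be run backward and forward (`c 0 ≠ 0 ≠ c d`). -/
def IsRecurrenceExtension {K : Type*} [Field K] (u : ℕ → K) (f : ℤ → K) : Prop :=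
  (∀ n : ℕ, f n = u n) ∧
    ∃ (d : ℕ) (c : ℕ → K), c 0 ≠ 0 ∧ c d ≠ 0 ∧
      ∀ n : ℤ, ∑ j ∈ Finset.range (d + 1), c j * f (n + j) = 0

open Classical in
/-- The continuation of `u` to the integers by a linear recurrence (`0` if there is none). -/
noncomputable def recurrenceExtension {K : Type*} [Field K] (u : ℕ → K) : ℤ → K :=
  if hu : ∃ f : ℤ → K, IsRecurrenceExtension u f then hu.choose else 0

/-- `GF(C_n^{(h)}(r → s); w)` for an integer `n`: for `n ≥ 0` it is the generating function of the
paths of length `n`, for `n < 0` it is the corresponding term in the continuation of the sequence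
`(GF(C_n^{(h)}(r → s); w))_{n ≥ 0}` by the linear recurrence that it satisfies. -/
noncomputable def pathGF {K : Type*} [Field K] (h : ℤ)
    (w : (n : ℕ) → (Fin (n + 1) → ℤ) → K) (r s : ℤ) : ℤ → K
  | Int.ofNat n => GF (upDownPaths h n r s) (w n)
  | Int.negSucc n =>
      recurrenceExtension (fun l : ℕ => GF (upDownPaths h l r s) (w l)) (Int.negSucc n)

/-- `GF(D_t^{(h)}; w) = GF(C_{t+h}^{(h)}(0 → h); w)`. -/
noncomputable def topGF {K : Type*} [Field K] (h : ℤ)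
    (w : (n : ℕ) → (Fin (n + 1) → ℤ) → K) (t : ℤ) : K :=
  pathGF h w 0 h (t + h)

/-- The operator `R_{AV}^{(N)}`, which replaces `A_i` by `V_{N+1-i}` and `V_i` by `A_{N+1-i}` for
all `i`, acting on expressions `F` in the variables `A_i`, `V_i`. -/
def RAV {K : Type*} (N : ℤ) (F : (ℤ → K) → (ℤ → K) → K) : (ℤ → K) → (ℤ → K) → K :=
  fun A V => F (fun i => V (N + 1 - i)) (fun i => A (N + 1 - i))

/-- The product `∏_{i=R}^{S-1} f(i)` in the extended sense: `∏_{i=S}^{R-1} f(i)⁻¹` if `R > S`. -/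
noncomputable def extProd {K : Type*} [Field K] (R S : ℤ) (f : ℤ → K) : K :=
  if R < S then ∏ i ∈ Finset.Ico R S, f i
  else if R = S then 1
  else ∏ i ∈ Finset.Ico S R, (f i)⁻¹

/-- The area `a(P)` of a Dyck path that starts at `(0,0)`: the number of squares with vertices
`(x,b)`, `(x-1,b+1)`, `(x+1,b+1)`, `(x,b+2)` that fit between the path and the zigzag path
`(0,0), (1,1), (2,0), (3,1), …`. -/
noncomputable def area (n : ℕ) (p : Fin (n + 1) → ℤ) : ℕ :=
  ∑ x : Fin (n + 1),
    Finset.card {b ∈ Finset.Ico 0 (p x) | b % 2 = ((x : ℕ) : ℤ) % 2 ∧ b + 2 ≤ p x}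

/-- The weight `q^{a(P)}`. -/
noncomputable def wArea {K : Type*} [Field K] (q : K) (n : ℕ) (p : Fin (n + 1) → ℤ) : K := q ^ area n p

end PathReciprocity

/-! ### Continuation of sequences by reversible linear recurrences -/

namespace PathReciprocity

/-! All the identities are instances of Jacobi's theorem: a minor of an invertible matrix is, up to
sign and the determinant, the complementary minor of its inverse. Put `N = k + m`, so that the strip
has the `2N` heights `0, …, 2N - 1`. Path generating functions are entries of powers `T ^ n` of the
one-step transfer matrix. `T` is invertible, so Cayley–Hamilton makes the entries of `T ^ z`, `z :
ℤ`, the continuation to negative lengths (`pathGF_eq_transfer_zpow`), and uniqueness makes this the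
only one.

A step changes parity, so `T` is off-diagonal with blocks `X = evenOdd` (lower bidiagonal, unit
diagonal) and `Y = oddEven` (upper bidiagonal, diagonal `B_1, B_3, …`). Thus everything happens in
`(X Y) ^ z` and `(X Y) ^ z * X`, of size `N`, and `det (X Y)` is the product of the odd-indexed `B`.
Jacobi (`det_submatrix_complementary`) exchanges starting and ending heights; reversing paths, which
conjugates by the diagonal matrix of the `descent` weights, exchanges them back. This gives (c) and
(d).

For (a), the first rows of `(X Y) ^ i`, `i < k`, form a unitriangular matrix supported on the first
`k` columns, so a Hankel determinant at height `0` is a top left minor of one power (`det_hankel`).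
Jacobi turns it into a bottom right minor of the inverse power, and a half-turn of the strip, which
is what `RAV` does to the weights, moves that minor back to the top left (`hankel_reciprocity`).
Part (b) does the same with top right minors (`det_toeplitz`, `toeplitz_reciprocity`).

For (e), the area of a path from `0` to `0` is the sum of `j - 1` over its down-steps from height
`j` (`area_eq_sum`), so `B_j = q ^ (j - 1)`. The half-turn yields `q ^ (2N - 2) * q⁻¹ ^ (j - 1)`,
and the constant factor only rescales the returns to `0` (`evenOdd_mul_oddEven_zpow_scale`). -/

theorem eq_zero_of_backward_recurrence {K : Type*} [Field K] {f : ℤ → K} {d : ℕ} {c : ℕ → K}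
    (hc : c 0 ≠ 0) (hrec : ∀ n : ℤ, ∑ j ∈ Finset.range (d + 1), c j * f (n + j) = 0)
    (hf : ∀ n : ℕ, f n = 0) : f = 0 := by
  have key : ∀ N : ℕ, ∀ z : ℤ, -(N : ℤ) ≤ z → f z = 0 := by
    intro N
    induction N with
    | zero =>
      intro z hz
      obtain ⟨n, rfl⟩ := Int.eq_ofNat_of_zero_le (by simpa using hz)
      exact hf n
    | succ N ih =>
      intro z hz
      rcases eq_or_lt_of_le hz with h | h
      -- All terms with index above `z` vanish already, so the recurrence at `z` reduces to `c 0 * f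
      -- z = 0`.
      · have h1 := hrec z
        rw [Finset.sum_range_succ', Finset.sum_eq_zero, zero_add] at h1
        · simpa [hc] using h1
        · intro j _
          rw [ih _ (by push_cast at h ⊢; omega), mul_zero]
      · exact ih z (by push_cast at h ⊢; omega)
  funext z
  exact key z.natAbs z (by omega)

/-- The two recurrences may differ, but as shift operators they commute, so their composite kills `f
- g`. Apply backward vanishing twice: first to the image of `f - g` under the second operator, then
to `f - g` itself. -/
theorem IsRecurrenceExtension.unique {K : Type*} [Field K] {u : ℕ → K} {f g : ℤ → K}
    (hf : IsRecurrenceExtension u f) (hg : IsRecurrenceExtension u g) : f = g := by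
  obtain ⟨hfu, d, c, hc, -, hfc⟩ := hf
  obtain ⟨hgu, d', c', hc', -, hgc⟩ := hg
  have hzero : ∀ n : ℕ, (f - g) n = 0 := fun n => by simp [hfu, hgu]
  have h1 : (fun z : ℤ => ∑ j ∈ Finset.range (d' + 1), c' j * (f - g) (z + j)) = 0 := by
    refine eq_zero_of_backward_recurrence (d := d) hc ?_ ?_
    · intro n
      simp only [Finset.mul_sum]
      rw [Finset.sum_comm]
      have : ∀ j ∈ Finset.range (d' + 1), ∑ i ∈ Finset.range (d + 1),
          c i * (c' j * (f - g) (n + i + j)) =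
          -(c' j * ∑ i ∈ Finset.range (d + 1), c i * g (n + i + j)) := by
        intro j _
        have h := hfc (n + j)
        have e : ∀ i : ℕ, n + (j : ℤ) + i = n + i + j := fun i => by ring
        simp only [e] at h
        simp only [Pi.sub_apply, mul_sub, Finset.sum_sub_distrib]
        have h2 : ∑ i ∈ Finset.range (d + 1), c i * (c' j * f (n + i + j)) = 0 := by
          have : ∀ i : ℕ, c i * (c' j * f (n + i + j)) = c' j * (c i * f (n + i + j)) :=
            fun i => by ring
          simp only [this, ← Finset.mul_sum, h, mul_zero]
        rw [h2, zero_sub, Finset.mul_sum]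
        congr 1
        exact Finset.sum_congr rfl fun i _ => by ring
      rw [Finset.sum_congr rfl this, Finset.sum_neg_distrib, neg_eq_zero]
      simp only [Finset.mul_sum]
      rw [Finset.sum_comm]
      refine Finset.sum_eq_zero fun i _ => ?_
      have h := hgc (n + i)
      have : ∀ j : ℕ, c' j * (c i * g (n + i + j)) = c i * (c' j * g (n + i + j)) :=
        fun j => by ring
      simp only [this, ← Finset.mul_sum, h, mul_zero]
    · intro n
      refine Finset.sum_eq_zero fun j _ => ?_
      have := hzero (n + j)
      push_cast at this
      rw [this, mul_zero]
  have h2 := eq_zero_of_backward_recurrence (d := d') hc' (fun n => congrFun h1 n) hzero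
  exact sub_eq_zero.1 h2

theorem isRecurrenceExtension_zero {K : Type*} [Field K] :
    IsRecurrenceExtension (fun _ : ℕ => (0 : K)) 0 :=
  ⟨fun _ => rfl, 0, fun _ => 1, one_ne_zero, one_ne_zero, fun n => by simp⟩

/-- The recurrence is Cayley–Hamilton: its last coefficient is the leading coefficient `1` of the
characteristic polynomial, and its first is the determinant up to sign. -/
theorem isRecurrenceExtension_zpow {K ι : Type*} [Field K] [Fintype ι] [DecidableEq ι]
    (T : Matrix ι ι K) (hT : IsUnit T.det) (a b : ι) :
    IsRecurrenceExtension (fun n : ℕ => (T ^ n) a b) (fun z : ℤ => (T ^ z) a b) := by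
  refine ⟨fun n => by simp, T.charpoly.natDegree, T.charpoly.coeff, ?_, ?_, ?_⟩
  · intro h
    rw [Matrix.det_eq_sign_charpoly_coeff, h, mul_zero] at hT
    simp at hT
  · rw [Polynomial.coeff_natDegree, T.charpoly_monic.leadingCoeff]
    exact one_ne_zero
  · intro n
    have h := T.aeval_self_charpoly
    rw [Polynomial.aeval_eq_sum_range] at h
    have h2 := congrArg (fun M => (T ^ n * M) a b) h
    simp only [Matrix.mul_zero, Matrix.zero_apply, Matrix.mul_sum, Matrix.mul_smul,
      Matrix.sum_apply, Matrix.smul_apply, smul_eq_mul] at h2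
    rw [← h2]
    refine Finset.sum_congr rfl fun j _ => ?_
    dsimp only
    rw [Matrix.zpow_add hT, zpow_natCast]

/-! ### Path generating functions as entries of matrix powers -/

/-- The weight of a step from height `x` to height `y` (`0` if there is no such step). -/
def stepWeight {K : Type*} [Field K] (B : ℤ → K) (x y : ℤ) : K :=
  if y = x + 1 then 1 else if y = x - 1 then B x else 0

theorem GF_eq_sum_prod_stepWeight {K : Type*} [Field K] (B : ℤ → K) (h : ℤ) (n : ℕ) (r s : ℤ) :
    GF (upDownPaths h n r s) (wB B n) =
      ∑ p ∈ Fintype.piFinset (fun _ : Fin (n + 1) => Finset.Icc 0 h),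
        if p 0 = r ∧ p (Fin.last n) = s then
          ∏ i : Fin n, stepWeight B (p i.castSucc) (p i.succ) else 0 := by
  unfold GF upDownPaths
  rw [Finset.sum_filter]
  refine Finset.sum_congr rfl fun p _ => ?_
  by_cases h1 : p 0 = r ∧ p (Fin.last n) = s
  · rw [if_pos h1]
    by_cases h2 : ∀ i : Fin n, p i.succ = p i.castSucc + 1 ∨ p i.succ = p i.castSucc - 1
    · rw [if_pos ⟨h1.1, h1.2, h2⟩]
      refine Finset.prod_congr rfl fun i _ => ?_
      unfold stepWeight
      rcases h2 i with h | h
      · rw [if_neg (by omega), if_pos h]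
      · rw [if_pos h, if_neg (by omega), if_pos h]
    · rw [if_neg (fun h => h2 h.2.2)]
      push Not at h2
      obtain ⟨i, hi1, hi2⟩ := h2
      refine (Finset.prod_eq_zero (Finset.mem_univ i) ?_).symm
      rw [stepWeight, if_neg hi1, if_neg hi2]
  · rw [if_neg h1, if_neg (fun h => h1 ⟨h.1, h.2.1⟩)]

theorem GF_zero {K : Type*} [Field K] (B : ℤ → K) {h r : ℤ} (hr : r ∈ Finset.Icc 0 h) (s : ℤ) :
    GF (upDownPaths h 0 r s) (wB B 0) = if r = s then 1 else 0 := by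
  rw [GF_eq_sum_prod_stepWeight]
  rw [Finset.sum_eq_single (fun _ => r)]
  · simp
  · intro p _ hp
    rw [if_neg]
    rintro ⟨h0, -⟩
    exact hp (funext fun i => by rw [show i = 0 from Fin.ext (by omega), h0])
  · intro hp
    exact absurd (Fintype.mem_piFinset.2 fun _ => hr) hp

theorem GF_succ {K : Type*} [Field K] (B : ℤ → K) {h r : ℤ} (hr : r ∈ Finset.Icc 0 h) (n : ℕ)
    (s : ℤ) :
    GF (upDownPaths h (n + 1) r s) (wB B (n + 1)) =
      ∑ x ∈ Finset.Icc 0 h, stepWeight B r x * GF (upDownPaths h n x s) (wB B n) := by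
  simp only [GF_eq_sum_prod_stepWeight, Finset.mul_sum]
  rw [Finset.sum_comm]
  have hR : ∀ p ∈ Fintype.piFinset (fun _ : Fin (n + 1) => Finset.Icc 0 h),
      (∑ x ∈ Finset.Icc 0 h, stepWeight B r x * (if p 0 = x ∧ p (Fin.last n) = s then
          ∏ i : Fin n, stepWeight B (p i.castSucc) (p i.succ) else 0)) =
      if p (Fin.last n) = s then stepWeight B r (p 0) *
          ∏ i : Fin n, stepWeight B (p i.castSucc) (p i.succ) else 0 := by
    intro p hp
    rw [Finset.sum_eq_single (p 0)]
    · simp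
    · intro x _ hx
      rw [if_neg (fun h => hx h.1.symm), mul_zero]
    · intro h0
      exact absurd (Fintype.mem_piFinset.1 hp 0) h0
  rw [Finset.sum_congr rfl hR]
  have hL : ∀ p : Fin (n + 1 + 1) → ℤ, (if p 0 = r ∧ p (Fin.last (n + 1)) = s then
          ∏ i : Fin (n + 1), stepWeight B (p i.castSucc) (p i.succ) else 0) =
      if p 0 = r then (if p (Fin.last (n + 1)) = s then
          ∏ i : Fin (n + 1), stepWeight B (p i.castSucc) (p i.succ) else 0) else 0 := by
    intro p
    by_cases h0 : p 0 = r <;> simp [h0]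
  rw [Finset.sum_congr rfl fun p _ => hL p, ← Finset.sum_filter]
  refine Finset.sum_bij' (fun p _ => Fin.tail p) (fun p _ => Fin.cons r p) ?_ ?_ ?_ ?_ ?_
  · intro p hp
    simp only [Finset.mem_filter, Fintype.mem_piFinset] at hp ⊢
    exact fun i => hp.1 i.succ
  · intro p hp
    simp only [Finset.mem_filter, Fintype.mem_piFinset] at hp ⊢
    refine ⟨fun i => ?_, rfl⟩
    refine Fin.cases ?_ (fun j => ?_) i
    · simpa using hr
    · simpa using hp j
  · intro p hp
    simp only [Finset.mem_filter] at hp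
    rw [← hp.2, Fin.cons_self_tail]
  · intro p _
    simp
  · intro p hp
    simp only [Finset.mem_filter] at hp
    rw [Fin.prod_univ_succ]
    simp only [Fin.tail, Fin.succ_last, Fin.castSucc_zero, hp.2]
    rfl

/-- The index type `ι` is left free so that the heights can be listed with the even ones first,
which brings out the block structure of the transfer matrix. -/
theorem GF_eq_pow {K ι : Type*} [Field K] [Fintype ι] [DecidableEq ι] (B : ℤ → K) (h : ℤ)
    (ht : ι → ℤ) (hinj : Function.Injective ht) (hmem : ∀ a, ht a ∈ Finset.Icc 0 h)
    (hsum : ∀ f : ℤ → K, ∑ x ∈ Finset.Icc 0 h, f x = ∑ a, f (ht a)) (n : ℕ) (a b : ι) :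
    GF (upDownPaths h n (ht a) (ht b)) (wB B n) =
      ((Matrix.of fun a b => stepWeight B (ht a) (ht b)) ^ n : Matrix ι ι K) a b := by
  induction n generalizing a with
  | zero =>
    rw [GF_zero B (hmem a), pow_zero, Matrix.one_apply]
    simp [hinj.eq_iff]
  | succ n ih =>
    rw [GF_succ B (hmem a), hsum, pow_succ', Matrix.mul_apply]
    simp [ih]

theorem GF_eq_zero_of_not_mem {K : Type*} [Field K] {h r s : ℤ}
    (hrs : ¬ (r ∈ Finset.Icc 0 h ∧ s ∈ Finset.Icc 0 h)) (n : ℕ) (w : (Fin (n + 1) → ℤ) → K) :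
    GF (upDownPaths h n r s) w = 0 := by
  have : upDownPaths h n r s = ∅ := by
    refine Finset.eq_empty_of_forall_notMem fun p hp => hrs ?_
    simp only [upDownPaths, Finset.mem_filter, Fintype.mem_piFinset] at hp
    exact ⟨hp.2.1 ▸ hp.1 0, hp.2.2.1 ▸ hp.1 (Fin.last n)⟩
  simp [GF, this]

theorem pathGF_eq_of_isRecurrenceExtension {K : Type*} [Field K] {h : ℤ}
    {w : (n : ℕ) → (Fin (n + 1) → ℤ) → K} {r s : ℤ} {f : ℤ → K}
    (hf : IsRecurrenceExtension (fun n : ℕ => GF (upDownPaths h n r s) (w n)) f) :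
    pathGF h w r s = f := by
  have hex : ∃ g : ℤ → K,
    IsRecurrenceExtension (fun n : ℕ => GF (upDownPaths h n r s) (w n)) g := ⟨f, hf⟩
  funext z
  cases z with
  | ofNat n => exact (hf.1 n).symm
  | negSucc n =>
    rw [pathGF, recurrenceExtension, dif_pos hex]
    exact congrFun (hex.choose_spec.unique hf) _

/-! ### Complementary minors of inverse matrices -/

section LinearAlgebra

variable {K : Type*} [Field K]

/-- Multiplying `P` by the identity with its second block column replaced by that of `Q` gives a
block lower triangular matrix with diagonal blocks `P₁₁` and `1`; compare determinants. -/
theorem det_toBlocks₁₁_of_mul_eq_one {α β : Type*} [Fintype α] [DecidableEq α] [Fintype β]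
    [DecidableEq β] {P Q : Matrix (α ⊕ β) (α ⊕ β) K} (h : P * Q = 1) :
    P.toBlocks₁₁.det = P.det * Q.toBlocks₂₂.det := by
  have hP : P = Matrix.fromBlocks P.toBlocks₁₁ P.toBlocks₁₂ P.toBlocks₂₁ P.toBlocks₂₂ :=
    (Matrix.fromBlocks_toBlocks P).symm
  have hQ : Q = Matrix.fromBlocks Q.toBlocks₁₁ Q.toBlocks₁₂ Q.toBlocks₂₁ Q.toBlocks₂₂ :=
    (Matrix.fromBlocks_toBlocks Q).symm
  have h' := h
  rw [hP, hQ, Matrix.fromBlocks_multiply, ← Matrix.fromBlocks_one, Matrix.fromBlocks_inj] at h'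
  obtain ⟨-, h12, -, h22⟩ := h'
  have key : P * Matrix.fromBlocks 1 Q.toBlocks₁₂ 0 Q.toBlocks₂₂ =
      Matrix.fromBlocks P.toBlocks₁₁ 0 P.toBlocks₂₁ 1 := by
    nth_rewrite 1 [hP]
    rw [Matrix.fromBlocks_multiply, h12, h22]
    simp
  have := congrArg Matrix.det key
  rw [Matrix.det_mul, Matrix.det_fromBlocks_zero₂₁, Matrix.det_fromBlocks_zero₁₂] at this
  simpa using this.symm

/-- The number of elements of the complement that lie below `r i` determines the sign of the
permutation that lists first the `r i` and then the `r' j` in increasing order. -/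
theorem sign_of_strictMono {k m : ℕ} {r : Fin k → Fin (k + m)} {r' : Fin m → Fin (k + m)}
    (hr : StrictMono r) (hr' : StrictMono r') (σ : Equiv.Perm (Fin (k + m)))
    (h1 : ∀ i, σ (Fin.castAdd m i) = r i) (h2 : ∀ j, σ (Fin.natAdd k j) = r' j) :
    ((Equiv.Perm.sign σ : ℤˣ) : ℤ) = (-1) ^ (∑ i, ((r i : ℕ) + i)) := by
  -- Below `r i` there are `r i` indices in all, of which exactly `i` are values of `r`; the others
  -- are the inversions in which `r i` takes part.
  have hcard : ∀ i : Fin k, (Finset.univ.filter fun j : Fin m => r' j < r i).card + i = r i := by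
    intro i
    have hc := Fintype.card_congr (σ.subtypeEquiv (p := fun x => σ x < r i) (q := fun y => y < r i)
      (fun _ => Iff.rfl))
    rw [Fintype.card_subtype, Fintype.card_subtype] at hc
    have e : (Finset.univ.filter fun y : Fin (k + m) => y < r i) = Finset.Iio (r i) := by
      ext; simp
    rw [e, Fin.card_Iio, Finset.card_filter, Fin.sum_univ_add] at hc
    simp only [h1, h2, ← Finset.card_filter, hr.lt_iff_lt] at hc
    have e : (Finset.univ.filter fun y : Fin k => y < i) = Finset.Iio i := by
      ext; simp
    rw [e, Fin.card_Iio] at hc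
    omega
  rw [Equiv.Perm.sign_eq_prod_prod_Ioi]
  push_cast
  have hIoi : ∀ i : Fin (k + m), ∏ j ∈ Finset.Ioi i,
      ((if σ i < σ j then 1 else -1 : ℤˣ) : ℤ) =
      ∏ j, if i < j then (if σ i < σ j then 1 else -1) else 1 := by
    intro i
    rw [← Finset.prod_filter]
    refine Finset.prod_congr (by ext; simp) fun j _ => ?_
    split_ifs <;> simp
  simp only [hIoi]
  simp only [Fin.prod_univ_add, h1, h2, hr.lt_iff_lt, hr'.lt_iff_lt]
  have hsame : ∀ {l : ℕ} (i j : Fin l), (if i < j then (if i < j then 1 else -1 : ℤ) else 1) = 1 :=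
    fun i j => by split_ifs <;> rfl
  have a1 : ∀ i j : Fin k, (if Fin.castAdd m i < Fin.castAdd m j then
      (if i < j then 1 else -1 : ℤ) else 1) = 1 := by
    intro i j
    simp only [(Fin.strictMono_castAdd m).lt_iff_lt, hsame]
  have a2 : ∀ i j : Fin m, (if Fin.natAdd k i < Fin.natAdd k j then
      (if i < j then 1 else -1 : ℤ) else 1) = 1 := by
    intro i j
    simp only [(Fin.strictMono_natAdd k).lt_iff_lt, hsame]
  have a3 : ∀ (i : Fin k) (j : Fin m), Fin.castAdd m i < Fin.natAdd k j := by
    intro i j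
    rw [Fin.lt_def]; simp; omega
  have a4 : ∀ (i : Fin k) (j : Fin m), ¬ Fin.natAdd k j < Fin.castAdd m i :=
    fun i j => (a3 i j).not_gt
  simp only [a1, a2, a3, a4, if_true, if_false, Finset.prod_const_one, one_mul, mul_one]
  rw [← Finset.prod_pow_eq_pow_sum]
  refine Finset.prod_congr rfl fun i _ => ?_
  have hne : ∀ j : Fin m, ¬ (r i < r' j) ↔ r' j < r i := by
    intro j
    rw [not_lt, le_iff_lt_or_eq, or_iff_left]
    intro h
    have h3 := σ.injective ((h1 i).trans (h.symm.trans (h2 j).symm))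
    exact (a3 i j).ne h3
  have : ∏ j : Fin m, (if r i < r' j then 1 else -1 : ℤ) =
      ∏ j : Fin m, (if r' j < r i then -1 else 1 : ℤ) := by
    refine Finset.prod_congr rfl fun j _ => ?_
    simp only [← hne j]
    split_ifs <;> rfl
  -- The inversion count `r i - i` is replaced by `r i + i`, which has the same parity and avoids
  -- subtraction.
  rw [this, ← Finset.prod_filter, Finset.prod_const, ← hcard i, add_assoc, pow_add]
  rw [Even.neg_one_pow ⟨(i : ℕ), rfl⟩, mul_one]

theorem exists_perm_of_complementary {k m : ℕ} {r : Fin k → Fin (k + m)}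
    {r' : Fin m → Fin (k + m)} (hr : StrictMono r) (hr' : StrictMono r')
    (hdisj : ∀ i j, r i ≠ r' j) :
    ∃ σ : Equiv.Perm (Fin (k + m)), (∀ i, σ (Fin.castAdd m i) = r i) ∧
      ∀ j, σ (Fin.natAdd k j) = r' j := by
  have hinj : Function.Injective (Fin.addCases r r' : Fin (k + m) → Fin (k + m)) := by
    intro x y
    refine Fin.addCases (fun i => ?_) (fun i => ?_) x <;>
    refine Fin.addCases (fun j => ?_) (fun j => ?_) y
    · simpa using fun h => hr.injective h
    · simpa using fun h => absurd h (hdisj i j)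
    · simpa using fun h => absurd h.symm (hdisj j i)
    · simpa using fun h => hr'.injective h
  exact ⟨Equiv.ofBijective _ (Finite.injective_iff_bijective.1 hinj), fun i => by simp,
    fun j => by simp⟩

/-- Jacobi's identity for complementary minors of inverse matrices. -/
theorem det_submatrix_complementary {k m : ℕ} {r s : Fin k → Fin (k + m)}
    {r' s' : Fin m → Fin (k + m)} (hr : StrictMono r) (hs : StrictMono s) (hr' : StrictMono r')
    (hs' : StrictMono s') (hrr : ∀ i j, r i ≠ r' j) (hss : ∀ i j, s i ≠ s' j)
    {P Q : Matrix (Fin (k + m)) (Fin (k + m)) K} (h : P * Q = 1) :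
    (P.submatrix r s).det =
      (-1) ^ (∑ i, ((r i : ℕ) + s i)) * P.det * (Q.submatrix s' r').det := by
  obtain ⟨σ, hσ1, hσ2⟩ := exists_perm_of_complementary hr hr' hrr
  obtain ⟨τ, hτ1, hτ2⟩ := exists_perm_of_complementary hs hs' hss
  have hσ := sign_of_strictMono hr hr' σ hσ1 hσ2
  have hτ := sign_of_strictMono hs hs' τ hτ1 hτ2
  let e : Fin k ⊕ Fin m ≃ Fin (k + m) := finSumFinEquiv
  -- Reordering rows by `σ` and columns by `τ` moves the chosen minor to the top left block; the
  -- inverse is reordered the other way round, which is why `s'` indexes the rows of its minor.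
  have hPQ : P.submatrix (e.trans σ) (e.trans τ) * Q.submatrix (e.trans τ) (e.trans σ) = 1 := by
    rw [Matrix.submatrix_mul_equiv, h, Matrix.submatrix_one_equiv]
  have key := det_toBlocks₁₁_of_mul_eq_one hPQ
  have e1 : (P.submatrix (e.trans σ) (e.trans τ)).toBlocks₁₁ = P.submatrix r s := by
    ext i j
    simp [Matrix.toBlocks₁₁, e, hσ1, hτ1]
  have e2 : (Q.submatrix (e.trans τ) (e.trans σ)).toBlocks₂₂ = Q.submatrix s' r' := by
    ext i j
    simp [Matrix.toBlocks₂₂, e, hσ2, hτ2]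
  have e3 : (P.submatrix (e.trans σ) (e.trans τ)).det =
      ((Equiv.Perm.sign σ : ℤˣ) : ℤ) * (((Equiv.Perm.sign τ : ℤˣ) : ℤ) * P.det) := by
    have : P.submatrix (e.trans σ) (e.trans τ) = (P.submatrix σ τ).submatrix e e := by
      ext; simp
    rw [this, Matrix.det_submatrix_equiv_self]
    have : P.submatrix σ τ = (P.submatrix id τ).submatrix σ id := by ext; simp
    rw [this, Matrix.det_permute, Matrix.det_permute']
  rw [e1, e2, e3, hσ, hτ] at key
  rw [key]
  push_cast
  have : ∑ i : Fin k, ((r i : ℕ) + i) + ∑ i : Fin k, ((s i : ℕ) + i) =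
      ∑ i, ((r i : ℕ) + s i) + 2 * ∑ i : Fin k, (i : ℕ) := by
    simp only [Finset.sum_add_distrib]; ring
  rw [← mul_assoc ((-1 : K) ^ _), ← pow_add, this, pow_add, pow_mul (-1 : K) 2]
  simp

theorem mul_eq_submatrix_mul {ι α β γ : Type*} [Fintype ι] [Fintype α]
    {L : Matrix β ι K} (P : Matrix ι γ K) {f : α → ι} (hf : Function.Injective f)
    (hL : ∀ i c, c ∉ Set.range f → L i c = 0) :
    L * P = L.submatrix id f * P.submatrix f id := by
  classical
  ext i j
  simp only [Matrix.mul_apply, Matrix.submatrix_apply, id]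
  rw [← Finset.sum_image (s := Finset.univ) (g := f) (f := fun c => L i c * P c j)
    (fun a _ b _ h => hf h)]
  refine (Finset.sum_subset (Finset.subset_univ _) fun c _ hc => ?_).symm
  rw [hL i c (by simpa using hc), zero_mul]

theorem mul_eq_mul_submatrix {ι α β γ : Type*} [Fintype ι] [Fintype α]
    {R : Matrix ι β K} (P : Matrix γ ι K) {g : α → ι} (hg : Function.Injective g)
    (hR : ∀ c j, c ∉ Set.range g → R c j = 0) :
    P * R = P.submatrix id g * R.submatrix g id := by
  have := mul_eq_submatrix_mul (L := R.transpose) P.transpose hg (fun i c hc => hR c i hc)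
  apply_fun Matrix.transpose at this
  simpa [Matrix.transpose_mul, Matrix.transpose_submatrix] using this

/-- The determinant of `L * P * R` when the rows of `L` and the columns of `R` are supported on
square index sets. -/
theorem det_mul_mul_of_support {ι ι' α : Type*} [Fintype ι] [Fintype ι'] [Fintype α]
    [DecidableEq α] {L : Matrix α ι K} (P : Matrix ι ι' K) {R : Matrix ι' α K}
    {f : α → ι} {g : α → ι'} (hf : Function.Injective f) (hg : Function.Injective g)
    (hL : ∀ i c, c ∉ Set.range f → L i c = 0) (hR : ∀ c j, c ∉ Set.range g → R c j = 0) :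
    (L * P * R).det =
      (L.submatrix id f).det * (P.submatrix f g).det * (R.submatrix g id).det := by
  rw [mul_eq_mul_submatrix _ hg hR, mul_eq_submatrix_mul P hf hL, Matrix.det_mul]
  rw [show (L.submatrix id f * P.submatrix f id).submatrix id g =
    L.submatrix id f * P.submatrix f g from by ext; simp [Matrix.mul_apply], Matrix.det_mul]

end LinearAlgebra

/-! ### The transfer matrix of the strip and its parity blocks -/

section TransferMatrix

variable {K : Type*} [Field K] (B : ℤ → K) (N : ℕ)

/-- The transfer matrix of a single step from an even height to an odd height. -/
def evenOdd : Matrix (Fin N) (Fin N) K :=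
  Matrix.of fun i j => stepWeight B (2 * (i : ℕ)) (2 * (j : ℕ) + 1)

/-- The transfer matrix of a single step from an odd height to an even height. -/
def oddEven : Matrix (Fin N) (Fin N) K :=
  Matrix.of fun i j => stepWeight B (2 * (i : ℕ) + 1) (2 * (j : ℕ))

/-- The heights of the strip `0 ≤ y ≤ 2N - 1`, the even ones first. -/
def height : Fin N ⊕ Fin N → ℤ :=
  Sum.elim (fun i => 2 * ((i : ℕ) : ℤ)) (fun i => 2 * ((i : ℕ) : ℤ) + 1)

/-- The transfer matrix of a single step. -/
def transfer : Matrix (Fin N ⊕ Fin N) (Fin N ⊕ Fin N) K :=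
  Matrix.of fun a b => stepWeight B (height N a) (height N b)

theorem transfer_eq_fromBlocks :
    transfer B N = Matrix.fromBlocks 0 (evenOdd B N) (oddEven B N) 0 := by
  ext a b
  rcases a with a | a <;> rcases b with b | b <;>
    simp only [transfer, height, Matrix.of_apply, Sum.elim_inl, Sum.elim_inr, evenOdd, oddEven,
      Matrix.fromBlocks_apply₁₁, Matrix.fromBlocks_apply₁₂, Matrix.fromBlocks_apply₂₁,
      Matrix.fromBlocks_apply₂₂, Matrix.zero_apply]
  all_goals
    rw [stepWeight, if_neg (by omega), if_neg (by omega)]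

theorem height_injective : Function.Injective (height N) := by
  intro a b h
  rcases a with a | a <;> rcases b with b | b <;>
    simp only [height, Sum.elim_inl, Sum.elim_inr] at h
  · congr 1; ext; omega
  · omega
  · omega
  · congr 1; ext; omega

theorem exists_height_eq_iff (x : ℤ) :
    (∃ a, height N a = x) ↔ x ∈ Finset.Icc 0 (2 * (N : ℤ) - 1) := by
  rw [Finset.mem_Icc]
  constructor
  · rintro ⟨a | a, rfl⟩ <;> simp only [height, Sum.elim_inl, Sum.elim_inr] <;> omega
  · rintro ⟨h0, h1⟩
    rcases Int.emod_two_eq_zero_or_one x with h | h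
    · refine ⟨Sum.inl ⟨(x / 2).toNat, by omega⟩, ?_⟩
      simp only [height, Sum.elim_inl]; omega
    · refine ⟨Sum.inr ⟨(x / 2).toNat, by omega⟩, ?_⟩
      simp only [height, Sum.elim_inr]; omega

theorem sum_Icc_eq_sum_height (f : ℤ → K) :
    ∑ x ∈ Finset.Icc 0 (2 * (N : ℤ) - 1), f x = ∑ a, f (height N a) := by
  rw [← Finset.sum_image (s := Finset.univ) (g := height N)
    (fun a _ b _ h => height_injective N h)]
  congr 1
  ext x
  rw [← exists_height_eq_iff]
  simp

theorem GF_eq_transfer_pow (n : ℕ) (a b : Fin N ⊕ Fin N) :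
    GF (upDownPaths (2 * (N : ℤ) - 1) n (height N a) (height N b)) (wB B n) =
      (transfer B N ^ n) a b :=
  GF_eq_pow B _ (height N) (height_injective N) (fun a => (exists_height_eq_iff N _).1 ⟨a, rfl⟩)
    (sum_Icc_eq_sum_height N) n a b

theorem evenOdd_isLowerTriangular : (evenOdd B N).IsLowerTriangular := by
  intro i j h
  have : i < j := h
  rw [evenOdd, Matrix.of_apply, stepWeight, if_neg (by omega), if_neg (by omega)]

theorem oddEven_isUpperTriangular : (oddEven B N).IsUpperTriangular := by
  intro i j h
  have : j < i := h
  rw [oddEven, Matrix.of_apply, stepWeight, if_neg (by omega), if_neg (by omega)]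

theorem evenOdd_diag (i : Fin N) : evenOdd B N i i = 1 := by
  rw [evenOdd, Matrix.of_apply, stepWeight, if_pos rfl]

theorem oddEven_diag (i : Fin N) : oddEven B N i i = B (2 * (i : ℕ) + 1) := by
  rw [oddEven, Matrix.of_apply, stepWeight, if_neg (by omega), if_pos (by ring)]

theorem det_evenOdd : (evenOdd B N).det = 1 := by
  rw [Matrix.det_of_isLowerTriangular _ (evenOdd_isLowerTriangular B N)]
  simp [evenOdd_diag]

theorem det_oddEven : (oddEven B N).det = ∏ i : Fin N, B (2 * (i : ℕ) + 1) := by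
  rw [Matrix.det_of_isUpperTriangular (oddEven_isUpperTriangular B N)]
  simp [oddEven_diag]

variable {B} (hB : ∀ j, B j ≠ 0)

theorem isUnit_det_evenOdd : IsUnit (evenOdd B N).det := by
  rw [det_evenOdd]; exact isUnit_one

include hB

theorem isUnit_det_oddEven : IsUnit (oddEven B N).det := by
  rw [det_oddEven, isUnit_iff_ne_zero]
  exact Finset.prod_ne_zero_iff.2 fun i _ => hB _

theorem isUnit_det_evenOdd_mul_oddEven : IsUnit (evenOdd B N * oddEven B N).det := by
  rw [Matrix.det_mul]
  exact (isUnit_det_evenOdd N).mul (isUnit_det_oddEven N hB)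

theorem isUnit_det_oddEven_mul_evenOdd : IsUnit (oddEven B N * evenOdd B N).det := by
  rw [Matrix.det_mul]
  exact (isUnit_det_oddEven N hB).mul (isUnit_det_evenOdd N)

theorem isUnit_det_transfer : IsUnit (transfer B N).det := by
  refine Matrix.isUnit_det_of_right_inverse
    (B := Matrix.fromBlocks 0 (oddEven B N)⁻¹ (evenOdd B N)⁻¹ 0) ?_
  rw [transfer_eq_fromBlocks, Matrix.fromBlocks_multiply,
    Matrix.mul_nonsing_inv _ (isUnit_det_evenOdd N),
    Matrix.mul_nonsing_inv _ (isUnit_det_oddEven N hB)]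
  simp

theorem pathGF_eq_transfer_zpow (a b : Fin N ⊕ Fin N) :
    pathGF (2 * (N : ℤ) - 1) (wB B) (height N a) (height N b) =
      fun z => (transfer B N ^ z) a b := by
  refine pathGF_eq_of_isRecurrenceExtension ?_
  simp only [GF_eq_transfer_pow]
  exact isRecurrenceExtension_zpow _ (isUnit_det_transfer N hB) a b

theorem existsUnique_isRecurrenceExtension (r s : ℤ) :
    ∃! f : ℤ → K, IsRecurrenceExtension
      (fun n : ℕ => GF (upDownPaths (2 * (N : ℤ) - 1) n r s) (wB B n)) f := by
  refine existsUnique_of_exists_of_unique ?_ fun f g hf hg => hf.unique hg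
  by_cases h : r ∈ Finset.Icc 0 (2 * (N : ℤ) - 1) ∧ s ∈ Finset.Icc 0 (2 * (N : ℤ) - 1)
  · obtain ⟨⟨a, rfl⟩, b, rfl⟩ := And.imp (exists_height_eq_iff N r).2 (exists_height_eq_iff N s).2 h
    simp only [GF_eq_transfer_pow]
    exact ⟨_, isRecurrenceExtension_zpow _ (isUnit_det_transfer N hB) a b⟩
  · simp only [GF_eq_zero_of_not_mem h]
    exact ⟨_, isRecurrenceExtension_zero⟩

omit hB in
theorem fromBlocks_diagonal_zpow {ι : Type*} [Fintype ι] [DecidableEq ι] {M M' : Matrix ι ι K}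
    (hM : IsUnit M.det) (hM' : IsUnit M'.det) (z : ℤ) :
    Matrix.fromBlocks M 0 0 M' ^ z = Matrix.fromBlocks (M ^ z) 0 0 (M' ^ z) := by
  cases z with
  | ofNat n =>
    simp only [Int.ofNat_eq_natCast, zpow_natCast]
    exact Matrix.fromBlocks_diagonal_pow M M' n
  | negSucc n =>
    simp only [zpow_negSucc]
    refine Matrix.inv_eq_right_inv ?_
    rw [Matrix.fromBlocks_diagonal_pow, Matrix.fromBlocks_multiply,
      Matrix.mul_nonsing_inv _ (by rw [Matrix.det_pow]; exact hM.pow _),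
      Matrix.mul_nonsing_inv _ (by rw [Matrix.det_pow]; exact hM'.pow _)]
    simp

/-- The square of the off-diagonal block matrix `transfer` is block diagonal, so even lengths never
mix the two parities. -/
theorem transfer_zpow_two_mul (z : ℤ) :
    transfer B N ^ (2 * z) = Matrix.fromBlocks ((evenOdd B N * oddEven B N) ^ z) 0 0
      ((oddEven B N * evenOdd B N) ^ z) := by
  rw [Matrix.zpow_mul _ (isUnit_det_transfer N hB),
    ← fromBlocks_diagonal_zpow (isUnit_det_evenOdd_mul_oddEven N hB)
      (isUnit_det_oddEven_mul_evenOdd N hB)]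
  congr 1
  rw [show (2 : ℤ) = ((2 : ℕ) : ℤ) from rfl, zpow_natCast, pow_two, transfer_eq_fromBlocks,
    Matrix.fromBlocks_multiply]
  simp

theorem pathGF_even (i j : Fin N) (z : ℤ) :
    pathGF (2 * (N : ℤ) - 1) (wB B) (2 * (i : ℕ)) (2 * (j : ℕ)) (2 * z) =
      ((evenOdd B N * oddEven B N) ^ z) i j := by
  have := congrFun (pathGF_eq_transfer_zpow N hB (Sum.inl i) (Sum.inl j)) (2 * z)
  rw [transfer_zpow_two_mul N hB] at this
  exact this

theorem pathGF_odd (i j : Fin N) (z : ℤ) :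
    pathGF (2 * (N : ℤ) - 1) (wB B) (2 * (i : ℕ)) (2 * (j : ℕ) + 1) (2 * z + 1) =
      ((evenOdd B N * oddEven B N) ^ z * evenOdd B N) i j := by
  have := congrFun (pathGF_eq_transfer_zpow N hB (Sum.inl i) (Sum.inr j)) (2 * z + 1)
  rw [Matrix.zpow_add_one (isUnit_det_transfer N hB), transfer_zpow_two_mul N hB,
    transfer_eq_fromBlocks, Matrix.fromBlocks_multiply] at this
  refine this.trans ?_
  simp

omit hB

variable (B) in
/-- The product `B_1 ⋯ B_x` of the weights of the down-steps from height `x` to height `0`. -/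
def descent (x : ℕ) : K := ∏ j ∈ Finset.range x, B (j + 1)

/-- Path reversal, one step at a time: the weight of a step `x → y` times `descent y` equals
`descent x` times the weight of the reversed step `y → x`. -/
theorem oddEven_mul_diagonal :
    oddEven B N * Matrix.diagonal (fun i : Fin N => descent B (2 * i)) =
      Matrix.diagonal (fun i : Fin N => descent B (2 * i + 1)) * (evenOdd B N).transpose := by
  ext i j
  rw [Matrix.mul_diagonal, Matrix.diagonal_mul, Matrix.transpose_apply, evenOdd, oddEven,
    Matrix.of_apply, Matrix.of_apply, stepWeight, stepWeight]
  by_cases h1 : (i : ℕ) = j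
  · rw [if_neg (by omega), if_pos (by omega), if_pos (by omega), h1]
    rw [descent, descent, Finset.prod_range_succ]
    push_cast; ring
  · by_cases h2 : (j : ℕ) = i + 1
    · rw [if_pos (by omega), if_neg (by omega), if_pos (by omega), h2]
      rw [show 2 * ((i : ℕ) + 1) = 2 * i + 1 + 1 by ring, descent, Finset.prod_range_succ, descent]
      push_cast
      ring_nf
    · rw [if_neg (by omega), if_neg (by omega), if_neg (by omega), if_neg (by omega)]
      ring

theorem evenOdd_mul_diagonal :
    evenOdd B N * Matrix.diagonal (fun i : Fin N => descent B (2 * i + 1)) =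
      Matrix.diagonal (fun i : Fin N => descent B (2 * i)) * (oddEven B N).transpose := by
  have := congrArg Matrix.transpose (oddEven_mul_diagonal (B := B) N)
  simpa [Matrix.transpose_mul] using this.symm

include hB

/-- A diagonal conjugation turns `evenOdd * oddEven` into its transpose. This undoes the exchange of
rows and columns in Jacobi's identity. -/
theorem zpow_mul_diagonal (z : ℤ) :
    (evenOdd B N * oddEven B N) ^ z * Matrix.diagonal (fun i : Fin N => descent B (2 * i)) =
      Matrix.diagonal (fun i : Fin N => descent B (2 * i)) *
        ((evenOdd B N * oddEven B N) ^ z).transpose := by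
  have h : SemiconjBy (Matrix.diagonal (fun i : Fin N => descent B (2 * i)))
      (evenOdd B N * oddEven B N).transpose (evenOdd B N * oddEven B N) := by
    rw [SemiconjBy, Matrix.mul_assoc (evenOdd B N), oddEven_mul_diagonal, ← Matrix.mul_assoc,
      evenOdd_mul_diagonal, Matrix.transpose_mul, Matrix.mul_assoc]
  have hu := isUnit_det_evenOdd_mul_oddEven N hB
  have := Matrix.SemiconjBy.zpow_right (by rwa [Matrix.det_transpose]) hu h z
  rw [Matrix.transpose_zpow]
  exact this.symm

theorem evenOdd_mul_oddEven_zpow_symm (z : ℤ) (i j : Fin N) :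
    ((evenOdd B N * oddEven B N) ^ z) i j * descent B (2 * j) =
      descent B (2 * i) * ((evenOdd B N * oddEven B N) ^ z) j i := by
  have := congrFun (congrFun (zpow_mul_diagonal N hB z) i) j
  rwa [Matrix.mul_diagonal, Matrix.diagonal_mul, Matrix.transpose_apply] at this

theorem oddEven_mul_zpow_symm (z : ℤ) (i j : Fin N) :
    (oddEven B N * (evenOdd B N * oddEven B N) ^ z) j i * descent B (2 * i) =
      descent B (2 * j + 1) * ((evenOdd B N * oddEven B N) ^ z * evenOdd B N) i j := by
  have h := zpow_mul_diagonal N hB z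
  have h2 := congrArg (oddEven B N * ·) h
  rw [← Matrix.mul_assoc, ← Matrix.mul_assoc, oddEven_mul_diagonal,
    Matrix.mul_assoc (Matrix.diagonal _), ← Matrix.transpose_mul] at h2
  have := congrFun (congrFun h2 j) i
  rwa [Matrix.mul_diagonal, Matrix.diagonal_mul, Matrix.transpose_apply] at this

theorem descent_ne_zero (x : ℕ) : descent B x ≠ 0 :=
  Finset.prod_ne_zero_iff.2 fun _ _ => hB _

omit hB in
theorem det_evenOdd_mul_oddEven : (evenOdd B N * oddEven B N).det =
    ∏ i : Fin N, B (2 * (i : ℕ) + 1) := by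
  rw [Matrix.det_mul, det_evenOdd, det_oddEven, one_mul]

end TransferMatrix

/-! ### Reciprocity for minors with prescribed heights -/

section Minors

variable {K : Type*} [Field K]

theorem det_zpow {ι : Type*} [Fintype ι] [DecidableEq ι] (M : Matrix ι ι K) (z : ℤ) :
    (M ^ z).det = M.det ^ z := by
  cases z with
  | ofNat n => simp [Matrix.det_pow]
  | negSucc n =>
    rw [zpow_negSucc, zpow_negSucc, Matrix.det_nonsing_inv, Matrix.det_pow, Ring.inverse_eq_inv']

theorem prod_mul_prod_complementary {M : Type*} [CommMonoid M] {k m : ℕ}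
    {r : Fin k → Fin (k + m)} {r' : Fin m → Fin (k + m)} (hr : StrictMono r) (hr' : StrictMono r')
    (hdisj : ∀ i j, r i ≠ r' j) (f : Fin (k + m) → M) :
    (∏ i, f (r i)) * ∏ j, f (r' j) = ∏ x, f x := by
  obtain ⟨σ, h1, h2⟩ := exists_perm_of_complementary hr hr' hdisj
  rw [← Equiv.prod_comp σ f, Fin.prod_univ_add]
  simp only [h1, h2]

theorem det_of_div_mul {ι : Type*} [Fintype ι] [DecidableEq ι] (a b : ι → K) (M : Matrix ι ι K) :
    (Matrix.of fun i j => a i / b j * M j i).det = (∏ i, a i / b i) * M.det := by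
  have : (Matrix.of fun i j => a i / b j * M j i) =
      Matrix.diagonal a * M.transpose * Matrix.diagonal (fun j => (b j)⁻¹) := by
    ext i j
    rw [Matrix.mul_diagonal, Matrix.diagonal_mul, Matrix.of_apply, Matrix.transpose_apply]
    ring
  rw [this, Matrix.det_mul, Matrix.det_mul, Matrix.det_diagonal, Matrix.det_diagonal,
    Matrix.det_transpose]
  simp only [div_eq_mul_inv, Finset.prod_mul_distrib]
  ring

variable {B : ℤ → K} (hB : ∀ j, B j ≠ 0) {k m : ℕ}
  {r s : Fin k → Fin (k + m)} {r' s' : Fin m → Fin (k + m)}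
  (hr : StrictMono r) (hs : StrictMono s) (hr' : StrictMono r') (hs' : StrictMono s')
  (hrr : ∀ i j, r i ≠ r' j) (hss : ∀ i j, s i ≠ s' j)

include hr hs hr' hs' hrr hss in
-- Each of `r, r'` and `s, s'` exhausts all indices, so both pairs have the same total, and the two
-- exponents add up to an even number.
theorem neg_one_pow_sum_complementary :
    (-1 : K) ^ (∑ i, ((r i : ℕ) + s i)) = (-1) ^ (∑ i, ((r' i : ℕ) + s' i)) := by
  have h1 := prod_mul_prod_complementary hr hr' hrr (fun x => (-1 : K) ^ (x : ℕ))
  have h2 := prod_mul_prod_complementary hs hs' hss (fun x => (-1 : K) ^ (x : ℕ))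
  rw [← h2] at h1
  simp only [Finset.prod_pow_eq_pow_sum] at h1
  simp only [Finset.sum_add_distrib, pow_add]
  have sq : ∀ n : ℕ, (-1 : K) ^ n * (-1) ^ n = 1 := fun n => by
    rw [← pow_add, Even.neg_one_pow ⟨n, rfl⟩]
  linear_combination (-1 : K) ^ (∑ i, (s i : ℕ)) * (-1) ^ (∑ i, (r' i : ℕ)) * h1 -
    (-1 : K) ^ (∑ i, (r i : ℕ)) * (-1) ^ (∑ i, (s i : ℕ)) *
    sq (∑ i, (r' i : ℕ)) + (-1 : K) ^ (∑ i, (r' i : ℕ)) * (-1) ^ (∑ i, (s' i : ℕ)) *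
    sq (∑ i, (s i : ℕ))

include hB hr hs hr' hs' hrr hss

theorem det_even_submatrix (z : ℤ) :
    (((evenOdd B (k + m) * oddEven B (k + m)) ^ z).submatrix r s).det =
      (-1) ^ (∑ i, ((r i : ℕ) + s i)) * (∏ i : Fin (k + m), B (2 * (i : ℕ) + 1)) ^ z *
        (∏ j, descent B (2 * s' j) / descent B (2 * r' j)) *
        (((evenOdd B (k + m) * oddEven B (k + m)) ^ (-z)).submatrix r' s').det := by
  have hu := isUnit_det_evenOdd_mul_oddEven (k + m) hB
  have hPQ : (evenOdd B (k + m) * oddEven B (k + m)) ^ z *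
      (evenOdd B (k + m) * oddEven B (k + m)) ^ (-z) = 1 := by
    rw [← Matrix.zpow_add hu, add_neg_cancel, zpow_zero]
  rw [det_submatrix_complementary hr hs hr' hs' hrr hss hPQ, det_zpow, det_evenOdd_mul_oddEven]
  have : ((evenOdd B (k + m) * oddEven B (k + m)) ^ (-z)).submatrix s' r' =
      Matrix.of fun i j => descent B (2 * s' i) / descent B (2 * r' j) *
        ((evenOdd B (k + m) * oddEven B (k + m)) ^ (-z)).submatrix r' s' j i := by
    ext i j
    have h := evenOdd_mul_oddEven_zpow_symm (k + m) hB (-z) (s' i) (r' j)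
    have hne := descent_ne_zero hB (2 * r' j)
    rw [Matrix.of_apply, Matrix.submatrix_apply, Matrix.submatrix_apply]
    field_simp
    linear_combination h
  rw [this, det_of_div_mul]
  ring

/-- With `X = evenOdd` and `Y = oddEven`, the inverse of `(X Y) ^ z * X` is `Y * (X Y) ^ (-z - 1)`,
and path reversal turns this into the transpose of `(X Y) ^ (-z - 1) * X`. -/
theorem det_odd_submatrix (z : ℤ) :
    (((evenOdd B (k + m) * oddEven B (k + m)) ^ z * evenOdd B (k + m)).submatrix r s).det =
      (-1) ^ (∑ i, ((r i : ℕ) + s i)) * (∏ i : Fin (k + m), B (2 * (i : ℕ) + 1)) ^ z *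
        (∏ j, descent B (2 * s' j + 1) / descent B (2 * r' j)) *
        (((evenOdd B (k + m) * oddEven B (k + m)) ^ (-z - 1) *
          evenOdd B (k + m)).submatrix r' s').det := by
  have hu := isUnit_det_evenOdd_mul_oddEven (k + m) hB
  have hPQ : (evenOdd B (k + m) * oddEven B (k + m)) ^ z * evenOdd B (k + m) *
      (oddEven B (k + m) * (evenOdd B (k + m) * oddEven B (k + m)) ^ (-z - 1)) = 1 := by
    rw [Matrix.mul_assoc, ← Matrix.mul_assoc (evenOdd B (k + m)), ← Matrix.zpow_one_add hu,
      ← Matrix.zpow_add hu]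
    rw [show z + (1 + (-z - 1)) = 0 by ring, zpow_zero]
  rw [det_submatrix_complementary hr hs hr' hs' hrr hss hPQ, Matrix.det_mul, det_zpow,
    det_evenOdd_mul_oddEven, det_evenOdd]
  have : (oddEven B (k + m) * (evenOdd B (k + m) * oddEven B (k + m)) ^ (-z - 1)).submatrix s' r' =
      Matrix.of fun i j => descent B (2 * s' i + 1) / descent B (2 * r' j) *
        ((evenOdd B (k + m) * oddEven B (k + m)) ^ (-z - 1) *
          evenOdd B (k + m)).submatrix r' s' j i := by
    ext i j
    have h := oddEven_mul_zpow_symm (k + m) hB (-z - 1) (r' j) (s' i)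
    have hne := descent_ne_zero hB (2 * r' j)
    rw [Matrix.of_apply, Matrix.submatrix_apply, Matrix.submatrix_apply]
    field_simp
    linear_combination h
  rw [this, det_of_div_mul]
  ring

theorem prod_descent_even_complementary :
    (∏ j, descent B (2 * r j) / descent B (2 * s j)) =
      ∏ j, descent B (2 * s' j) / descent B (2 * r' j) := by
  have h1 := prod_mul_prod_complementary hr hr' hrr (fun x => descent B (2 * x))
  have h2 := prod_mul_prod_complementary hs hs' hss (fun x => descent B (2 * x))
  rw [Finset.prod_div_distrib, Finset.prod_div_distrib, div_eq_div_iff, h1, mul_comm, h2] <;>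
    exact Finset.prod_ne_zero_iff.2 fun i _ => descent_ne_zero hB _

/-- Over all heights, odd descents exceed even ones by the product of the odd-indexed `B`. This is
the discrepancy between the exponents `-n` and `-n + 1` in the two forms of (d). -/
theorem prod_descent_odd_complementary :
    (∏ i : Fin (k + m), B (2 * (i : ℕ) + 1)) *
      (∏ j, descent B (2 * r j) / descent B (2 * s j + 1)) =
      ∏ j, descent B (2 * s' j + 1) / descent B (2 * r' j) := by
  have h1 := prod_mul_prod_complementary hr hr' hrr (fun x => descent B (2 * x))
  have h2 := prod_mul_prod_complementary hs hs' hss (fun x => descent B (2 * x + 1))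
  have h3 : ∏ x : Fin (k + m), descent B (2 * x + 1) =
      (∏ x : Fin (k + m), descent B (2 * x)) * ∏ i : Fin (k + m), B (2 * (i : ℕ) + 1) := by
    rw [← Finset.prod_mul_distrib]
    refine Finset.prod_congr rfl fun i _ => ?_
    rw [descent, Finset.prod_range_succ, descent]
    push_cast; rfl
  have n1 : ∏ j, descent B (2 * s j + 1) ≠ 0 :=
    Finset.prod_ne_zero_iff.2 fun i _ => descent_ne_zero hB _
  have n2 : ∏ j, descent B (2 * r' j) ≠ 0 :=
    Finset.prod_ne_zero_iff.2 fun i _ => descent_ne_zero hB _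
  rw [Finset.prod_div_distrib, Finset.prod_div_distrib, mul_div_assoc', div_eq_div_iff n1 n2]
  rw [h3, ← h1] at h2
  linear_combination -h2

end Minors

/-! ### Hankel and Toeplitz determinants as minors of a single power -/

section Krylov

variable {K : Type*} [Field K]

/-- Each factor raises the index by at most one, and by exactly one only with weight `1`; so at
distance `n` a single product survives, and beyond that none. -/
theorem pow_apply_of_superdiagonal {N : ℕ} {M : Matrix (Fin N) (Fin N) K}
    (h0 : ∀ i j : Fin N, (i : ℕ) + 1 < j → M i j = 0)
    (h1 : ∀ i j : Fin N, (i : ℕ) + 1 = j → M i j = 1) (n : ℕ) (i j : Fin N) (hij : (i : ℕ) + n ≤ j) :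
    (M ^ n) i j = if (i : ℕ) + n = j then 1 else 0 := by
  induction n generalizing i with
  | zero =>
    rw [pow_zero, Matrix.one_apply, add_zero]
    simp [Fin.ext_iff]
  | succ n ih =>
    rw [pow_succ', Matrix.mul_apply, Finset.sum_eq_single ⟨i + 1, by omega⟩]
    · rw [h1 _ _ rfl, one_mul, ih _ (by simp; omega)]
      congr 1
      simp only [eq_iff_iff]
      omega
    · intro l _ hl
      have hl' : (l : ℕ) ≠ i + 1 := fun h => hl (Fin.ext h)
      rcases lt_or_gt_of_ne hl' with h | h
      · rw [ih l (by omega), if_neg (by omega), mul_zero]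
      · rw [h0 _ _ h, zero_mul]
    · simp

variable (B : ℤ → K) (N : ℕ)

theorem evenOdd_apply (i j : Fin N) : evenOdd B N i j =
    if (j : ℕ) = i then 1 else if (j : ℕ) + 1 = i then B (2 * (i : ℕ)) else 0 := by
  rw [evenOdd, Matrix.of_apply, stepWeight]
  congr 1
  · simp only [eq_iff_iff]; omega
  · congr 1
    simp only [eq_iff_iff]; omega

theorem oddEven_apply (i j : Fin N) : oddEven B N i j =
    if (j : ℕ) = i + 1 then 1 else if (j : ℕ) = i then B (2 * (i : ℕ) + 1) else 0 := by
  rw [oddEven, Matrix.of_apply, stepWeight]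
  congr 1
  · simp only [eq_iff_iff]; omega
  · congr 1
    simp only [eq_iff_iff]; omega

theorem evenOdd_mul_oddEven_superdiagonal (i j : Fin N) (h : (i : ℕ) + 1 ≤ j) :
    (evenOdd B N * oddEven B N) i j = if (i : ℕ) + 1 = j then 1 else 0 := by
  rw [Matrix.mul_apply, Finset.sum_eq_single i]
  · rw [evenOdd_apply, if_pos rfl, one_mul, oddEven_apply]
    by_cases h' : (i : ℕ) + 1 = j
    · rw [if_pos h'.symm, if_pos h']
    · rw [if_neg (Ne.symm h'), if_neg (by omega), if_neg h']
  · intro l _ hl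
    have hl' : (l : ℕ) ≠ i := fun h => hl (Fin.ext h)
    rw [evenOdd_apply, if_neg hl', oddEven_apply]
    by_cases h1 : (l : ℕ) + 1 = i
    · rw [if_pos h1, if_neg (by omega), if_neg (by omega), mul_zero]
    · rw [if_neg h1, zero_mul]
  · simp

theorem oddEven_mul_evenOdd_superdiagonal (i j : Fin N) (h : (i : ℕ) + 1 ≤ j) :
    (oddEven B N * evenOdd B N) i j = if (i : ℕ) + 1 = j then 1 else 0 := by
  rw [Matrix.mul_apply, Finset.sum_eq_single j]
  · rw [evenOdd_apply, if_pos rfl, mul_one, oddEven_apply]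
    by_cases h' : (i : ℕ) + 1 = j
    · rw [if_pos h'.symm, if_pos h']
    · rw [if_neg (Ne.symm h'), if_neg (by omega), if_neg h']
  · intro l _ hl
    have hl' : (l : ℕ) ≠ j := fun h => hl (Fin.ext h)
    rw [evenOdd_apply, if_neg hl'.symm, oddEven_apply]
    by_cases h1 : (j : ℕ) + 1 = l
    · rw [if_neg (by omega), if_neg (by omega), zero_mul]
    · rw [if_neg h1, mul_zero]
  · simp

theorem evenOdd_mul_oddEven_pow_apply (n : ℕ) (i j : Fin N) (hij : (i : ℕ) + n ≤ j) :
    ((evenOdd B N * oddEven B N) ^ n) i j = if (i : ℕ) + n = j then 1 else 0 := by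
  refine pow_apply_of_superdiagonal ?_ ?_ n i j hij
  · intro i j h
    rw [evenOdd_mul_oddEven_superdiagonal B N i j h.le, if_neg h.ne]
  · intro i j h
    rw [evenOdd_mul_oddEven_superdiagonal B N i j h.le, if_pos h]

theorem oddEven_mul_evenOdd_pow_apply (n : ℕ) (i j : Fin N) (hij : (i : ℕ) + n ≤ j) :
    ((oddEven B N * evenOdd B N) ^ n) i j = if (i : ℕ) + n = j then 1 else 0 := by
  refine pow_apply_of_superdiagonal ?_ ?_ n i j hij
  · intro i j h
    rw [oddEven_mul_evenOdd_superdiagonal B N i j h.le, if_neg h.ne]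
  · intro i j h
    rw [oddEven_mul_evenOdd_superdiagonal B N i j h.le, if_pos h]

variable {B} (hB : ∀ j, B j ≠ 0)
include hB

theorem evenOdd_mul_oddEven_pow_apply_zero [NeZero N] (n : ℕ) (i : Fin N) :
    ((evenOdd B N * oddEven B N) ^ n) i 0 =
      descent B (2 * i) * ((evenOdd B N * oddEven B N) ^ n) 0 i := by
  have := evenOdd_mul_oddEven_zpow_symm N hB n i 0
  rw [zpow_natCast] at this
  simpa [descent] using this

/-- Hankel determinants of the returns to height `0` are top left minors. -/
theorem det_hankel [NeZero N] {k : ℕ} (hk : k ≤ N) (p : ℤ) :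
    (Matrix.of fun i j : Fin k =>
      ((evenOdd B N * oddEven B N) ^ (p + (i : ℕ) + (j : ℕ))) 0 0).det =
      (∏ i : Fin k, descent B (2 * i)) *
        (((evenOdd B N * oddEven B N) ^ p).submatrix (Fin.castLE hk) (Fin.castLE hk)).det := by
  have hu := isUnit_det_evenOdd_mul_oddEven N hB
  -- Splitting the exponent as `i + p + j` factors the Hankel matrix as `L * (X Y) ^ p * R`. `L` is
  -- unitriangular on the first `k` columns, and `R` is its transpose scaled by `descent`.
  let L : Matrix (Fin k) (Fin N) K := Matrix.of fun i c => ((evenOdd B N * oddEven B N) ^ (i : ℕ)) 0 c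
  let R : Matrix (Fin N) (Fin k) K := Matrix.of fun c j => ((evenOdd B N * oddEven B N) ^ (j : ℕ)) c 0
  have e : (Matrix.of fun i j : Fin k =>
      ((evenOdd B N * oddEven B N) ^ (p + (i : ℕ) + (j : ℕ))) 0 0) =
      L * (evenOdd B N * oddEven B N) ^ p * R := by
    ext i j
    rw [Matrix.of_apply, show p + (i : ℕ) + (j : ℕ) = (i : ℕ) + p + (j : ℕ) by ring,
      Matrix.zpow_add hu, Matrix.zpow_add hu, zpow_natCast, zpow_natCast]
    simp only [Matrix.mul_apply, L, R, Matrix.of_apply]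
  have hL : ∀ (i : Fin k) (c : Fin N), (i : ℕ) ≤ c → L i c = if (i : ℕ) = c then 1 else 0 := by
    intro i c h
    have := evenOdd_mul_oddEven_pow_apply B N i 0 c (by simpa using h)
    simpa [L] using this
  have hR : ∀ (c : Fin N) (i : Fin k), R c i = descent B (2 * c) * L i c := fun c i =>
    evenOdd_mul_oddEven_pow_apply_zero N hB i c
  have hsupp : ∀ (i : Fin k) (c : Fin N), c ∉ Set.range (Fin.castLE hk) → L i c = 0 := by
    intro i c hc
    have : k ≤ (c : ℕ) := by
      by_contra! h
      exact hc ⟨⟨c, h⟩, rfl⟩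
    rw [hL i c (by omega), if_neg (by omega)]
  have hdetL : (L.submatrix id (Fin.castLE hk)).det = 1 := by
    rw [Matrix.det_of_isLowerTriangular]
    · refine Finset.prod_eq_one fun i _ => ?_
      rw [Matrix.submatrix_apply, id, hL _ _ le_rfl]
      exact if_pos rfl
    · intro i j h
      have h' : (i : ℕ) < j := h
      rw [Matrix.submatrix_apply, id, hL _ _ (by simpa using h'.le), if_neg (by simpa using h'.ne)]
  have hdetR : (R.submatrix (Fin.castLE hk) id).det = ∏ i : Fin k, descent B (2 * i) := by
    have : R.submatrix (Fin.castLE hk) id = Matrix.diagonal (fun i : Fin k => descent B (2 * i)) *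
        (L.submatrix id (Fin.castLE hk)).transpose := by
      ext i j
      rw [Matrix.diagonal_mul, Matrix.submatrix_apply, hR]
      rfl
    rw [this, Matrix.det_mul, Matrix.det_transpose, hdetL, Matrix.det_diagonal, mul_one]
  rw [e, det_mul_mul_of_support _ (Fin.castLE_injective hk) (Fin.castLE_injective hk) hsupp
    (fun c j hc => by rw [hR, hsupp j c hc, mul_zero]), hdetL, hdetR]
  ring

theorem oddEven_mul_zpow (z : ℤ) :
    oddEven B N * (evenOdd B N * oddEven B N) ^ z =
      (oddEven B N * evenOdd B N) ^ z * oddEven B N := by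
  have h : SemiconjBy (oddEven B N) (evenOdd B N * oddEven B N) (oddEven B N * evenOdd B N) := by
    rw [SemiconjBy, Matrix.mul_assoc]
  exact Matrix.SemiconjBy.zpow_right (isUnit_det_evenOdd_mul_oddEven N hB)
    (isUnit_det_oddEven_mul_evenOdd N hB) h z

theorem evenOdd_mul_zpow (z : ℤ) :
    evenOdd B N * (oddEven B N * evenOdd B N) ^ z =
      (evenOdd B N * oddEven B N) ^ z * evenOdd B N := by
  have h : SemiconjBy (evenOdd B N) (oddEven B N * evenOdd B N) (evenOdd B N * oddEven B N) := by
    rw [SemiconjBy, Matrix.mul_assoc]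
  exact Matrix.SemiconjBy.zpow_right (isUnit_det_oddEven_mul_evenOdd N hB)
    (isUnit_det_evenOdd_mul_oddEven N hB) h z

/-- Toeplitz determinants of the paths from height `0` to the maximal height are top right
minors. -/
theorem det_toeplitz [NeZero N] {k m : ℕ} (hN : N = m + k) (p : ℤ) (last : Fin N)
    (hlast : (last : ℕ) + 1 = N) :
    (Matrix.of fun i j : Fin k =>
      ((evenOdd B N * oddEven B N) ^ (p + (i : ℕ) + ((j.rev : Fin k) : ℕ)) * evenOdd B N) 0 last).det =
        (((evenOdd B N * oddEven B N) ^ p * evenOdd B N).submatrix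
          (fun i : Fin k => (⟨i, by omega⟩ : Fin N)) (fun j : Fin k => ⟨m + j, by omega⟩)).det := by
  have hu := isUnit_det_evenOdd_mul_oddEven N hB
  let L : Matrix (Fin k) (Fin N) K := Matrix.of fun i c => ((evenOdd B N * oddEven B N) ^ (i : ℕ)) 0 c
  -- The last column of a power with exponent `k - 1 - j` starts in row `m + j`; reversing `j`
  -- therefore makes the last `k` rows of `R` lower unitriangular.
  let R : Matrix (Fin N) (Fin k) K :=
    Matrix.of fun c j => ((oddEven B N * evenOdd B N) ^ ((j.rev : Fin k) : ℕ)) c last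
  have e : (Matrix.of fun i j : Fin k =>
      ((evenOdd B N * oddEven B N) ^ (p + (i : ℕ) + ((j.rev : Fin k) : ℕ)) * evenOdd B N) 0 last) =
      L * ((evenOdd B N * oddEven B N) ^ p * evenOdd B N) * R := by
    ext i j
    rw [Matrix.of_apply, Matrix.zpow_add hu, Matrix.mul_assoc, ← evenOdd_mul_zpow N hB,
      show p + (i : ℕ) = (i : ℕ) + p by ring,
      Matrix.zpow_add hu, zpow_natCast, zpow_natCast, ← Matrix.mul_assoc,
      Matrix.mul_assoc (_ ^ (i : ℕ)) (_ ^ p)]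
    simp only [Matrix.mul_apply, L, R, Matrix.of_apply]
  have hL : ∀ (i : Fin k) (c : Fin N), (i : ℕ) ≤ c → L i c = if (i : ℕ) = c then 1 else 0 := by
    intro i c h
    have := evenOdd_mul_oddEven_pow_apply B N i 0 c (by simpa using h)
    simpa [L] using this
  have hR : ∀ (c : Fin N) (j : Fin k), (c : ℕ) ≤ m + j →
      R c j = if (c : ℕ) = m + j then 1 else 0 := by
    intro c j h
    have hrev : ((j.rev : Fin k) : ℕ) = k - (j + 1) := Fin.val_rev j
    have := oddEven_mul_evenOdd_pow_apply B N ((j.rev : Fin k) : ℕ) c last (by omega)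
    refine Eq.trans this ?_
    congr 1
    simp only [eq_iff_iff]
    omega
  rw [e, det_mul_mul_of_support _ (f := fun i : Fin k => (⟨i, by omega⟩ : Fin N))
    (g := fun j : Fin k => (⟨m + j, by omega⟩ : Fin N))]
  · have h1 : (L.submatrix id fun i : Fin k => (⟨i, by omega⟩ : Fin N)).det = 1 := by
      rw [Matrix.det_of_isLowerTriangular]
      · refine Finset.prod_eq_one fun i _ => ?_
        rw [Matrix.submatrix_apply, id, hL _ _ le_rfl, if_pos rfl]
      · intro i j h
        have h' : (i : ℕ) < j := h
        rw [Matrix.submatrix_apply, id, hL _ _ (by simpa using h'.le),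
          if_neg (by simpa using h'.ne)]
    have h2 : (R.submatrix (fun j : Fin k => (⟨m + j, by omega⟩ : Fin N)) id).det = 1 := by
      rw [Matrix.det_of_isLowerTriangular]
      · refine Finset.prod_eq_one fun i _ => ?_
        rw [Matrix.submatrix_apply, id, hR _ _ le_rfl, if_pos rfl]
      · intro i j h
        have h' : (i : ℕ) < j := h
        rw [Matrix.submatrix_apply, id, hR _ _ (by simpa using h'.le),
          if_neg (by simpa using h'.ne)]
    rw [h1, h2, one_mul, mul_one]
  · intro i j h
    simpa [Fin.ext_iff] using h
  · intro i j h
    simpa [Fin.ext_iff] using h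
  · intro i c hc
    have : k ≤ (c : ℕ) := by
      by_contra! h
      exact hc ⟨⟨c, h⟩, rfl⟩
    rw [hL i c (by omega), if_neg (by omega)]
  · intro c j hc
    have : (c : ℕ) < m := by
      by_contra! h
      exact hc ⟨⟨c - m, by omega⟩, Fin.ext (by simp; omega)⟩
    rw [hR c j (by omega), if_neg (by omega)]

end Krylov

/-! ### The half-turn of the strip -/

section Reflection

variable {K : Type*} [Field K]

theorem submatrix_equiv_zpow {ι : Type*} [Fintype ι] [DecidableEq ι] (M : Matrix ι ι K)
    (e : ι ≃ ι) (z : ℤ) : M.submatrix e e ^ z = (M ^ z).submatrix e e := by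
  have hn : ∀ n : ℕ, M.submatrix e e ^ n = (M ^ n).submatrix e e := by
    intro n
    induction n with
    | zero => simp
    | succ n ih => rw [pow_succ, ih, Matrix.submatrix_mul_equiv, ← pow_succ]
  cases z with
  | ofNat n => simpa using hn n
  | negSucc n => rw [zpow_negSucc, zpow_negSucc, hn, Matrix.inv_submatrix_equiv]

theorem det_of_rev {k : ℕ} (f : Fin k → Fin k → K) :
    (Matrix.of f).det = (Matrix.of fun i j : Fin k => f i.rev j.rev).det :=
  (Matrix.det_submatrix_equiv_self Fin.revPerm (Matrix.of f)).symm

variable (B : ℤ → K) (N : ℕ)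

/-- A half-turn sends height `x` to `2N - 1 - x` and reverses time. A down-step from `j` becomes a
down-step from `2N - j`, and steps from even to odd heights remain such. -/
theorem evenOdd_reflect : evenOdd (fun j => B (2 * (N : ℤ) - j)) N =
    ((evenOdd B N).submatrix Fin.revPerm Fin.revPerm).transpose := by
  ext i j
  simp only [Matrix.transpose_apply, Matrix.submatrix_apply, evenOdd_apply, Fin.revPerm_apply,
    Fin.val_rev]
  by_cases h1 : (j : ℕ) = i
  · rw [if_pos h1, if_pos (by omega)]
  · by_cases h2 : (j : ℕ) + 1 = i
    · rw [if_neg h1, if_pos h2, if_neg (by omega), if_pos (by omega)]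
      congr 1
      omega
    · rw [if_neg h1, if_neg h2, if_neg (by omega), if_neg (by omega)]

theorem oddEven_reflect : oddEven (fun j => B (2 * (N : ℤ) - j)) N =
    ((oddEven B N).submatrix Fin.revPerm Fin.revPerm).transpose := by
  ext i j
  simp only [Matrix.transpose_apply, Matrix.submatrix_apply, oddEven_apply, Fin.revPerm_apply,
    Fin.val_rev]
  by_cases h1 : (j : ℕ) = i + 1
  · rw [if_pos h1, if_pos (by omega)]
  · by_cases h2 : (j : ℕ) = i
    · rw [if_neg h1, if_pos h2, if_neg (by omega), if_pos (by omega)]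
      congr 1
      omega
    · rw [if_neg h1, if_neg h2, if_neg (by omega), if_neg (by omega)]

theorem evenOdd_mul_oddEven_zpow_reflect (z : ℤ) :
    (evenOdd (fun j => B (2 * (N : ℤ) - j)) N * oddEven (fun j => B (2 * (N : ℤ) - j)) N) ^ z =
      (((oddEven B N * evenOdd B N) ^ z).submatrix Fin.revPerm Fin.revPerm).transpose := by
  rw [evenOdd_reflect, oddEven_reflect, ← Matrix.transpose_mul, Matrix.submatrix_mul_equiv,
    ← Matrix.transpose_zpow, submatrix_equiv_zpow]

theorem evenOdd_mul_oddEven_zpow_mul_reflect (hB : ∀ j, B j ≠ 0) (z : ℤ) :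
    (evenOdd (fun j => B (2 * (N : ℤ) - j)) N * oddEven (fun j => B (2 * (N : ℤ) - j)) N) ^ z *
        evenOdd (fun j => B (2 * (N : ℤ) - j)) N =
      (((evenOdd B N * oddEven B N) ^ z * evenOdd B N).submatrix
        Fin.revPerm Fin.revPerm).transpose := by
  rw [evenOdd_mul_oddEven_zpow_reflect, evenOdd_reflect, ← Matrix.transpose_mul,
    Matrix.submatrix_mul_equiv, evenOdd_mul_zpow N hB]

end Reflection

/-! ### Hankel and Toeplitz reciprocity for arbitrary down-step weights -/

section Reciprocity

variable {K : Type*} [Field K] {B : ℤ → K} (hB : ∀ j, B j ≠ 0)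
include hB

/-- With `X = evenOdd` and `Y = oddEven`, `(Y X) ^ (z + 1) = Y * (X Y) ^ z * X`. Since `Y` is upper
and `X` lower triangular, bottom right minors only pick up the last `m` diagonal entries of `Y`. -/
theorem det_bottom_oddEven_mul_evenOdd_zpow (k m : ℕ) (z : ℤ) :
    (((oddEven B (k + m) * evenOdd B (k + m)) ^ (z + 1)).submatrix
        (Fin.natAdd k) (Fin.natAdd k)).det =
      (∏ j : Fin m, B (2 * ((k + j : ℕ) : ℤ) + 1)) *
        (((evenOdd B (k + m) * oddEven B (k + m)) ^ z).submatrix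
          (Fin.natAdd k) (Fin.natAdd k)).det := by
  have e : (oddEven B (k + m) * evenOdd B (k + m)) ^ (z + 1) =
      oddEven B (k + m) * (evenOdd B (k + m) * oddEven B (k + m)) ^ z * evenOdd B (k + m) := by
    rw [Matrix.zpow_add_one (isUnit_det_oddEven_mul_evenOdd _ hB), oddEven_mul_zpow _ hB,
      Matrix.mul_assoc]
  have e2 : ((oddEven B (k + m) * evenOdd B (k + m)) ^ (z + 1)).submatrix
        (Fin.natAdd k : Fin m → Fin (k + m)) (Fin.natAdd k) =
      (oddEven B (k + m)).submatrix (Fin.natAdd k) id *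
        (evenOdd B (k + m) * oddEven B (k + m)) ^ z *
        (evenOdd B (k + m)).submatrix id (Fin.natAdd k) := by
    rw [e]
    ext i j
    simp only [Matrix.mul_apply, Matrix.submatrix_apply, id]
  have hc : ∀ c : Fin (k + m), c ∉ Set.range (Fin.natAdd k : Fin m → Fin (k + m)) →
      (c : ℕ) < k := by
    intro c hc
    by_contra! h
    exact hc ⟨⟨c - k, by omega⟩, Fin.ext (by simp; omega)⟩
  rw [e2, det_mul_mul_of_support _ (Fin.natAdd_injective m k) (Fin.natAdd_injective m k)]
  · have h1 : (((oddEven B (k + m)).submatrix (Fin.natAdd k : Fin m → Fin (k + m)) id).submatrix id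
        (Fin.natAdd k : Fin m → Fin (k + m))).det = ∏ j : Fin m, B (2 * ((k + j : ℕ) : ℤ) + 1) := by
      rw [Matrix.det_of_isUpperTriangular]
      · refine Finset.prod_congr rfl fun i _ => ?_
        simp only [Matrix.submatrix_apply, id, oddEven_diag, Fin.val_natAdd]
      · intro i j h
        exact oddEven_isUpperTriangular B (k + m) ((Fin.strictMono_natAdd k) h)
    have h2 : (((evenOdd B (k + m)).submatrix id (Fin.natAdd k : Fin m → Fin (k + m))).submatrix
        (Fin.natAdd k : Fin m → Fin (k + m)) id).det = 1 := by
      rw [Matrix.det_of_isLowerTriangular]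
      · refine Finset.prod_eq_one fun i _ => ?_
        simp only [Matrix.submatrix_apply, id, evenOdd_diag]
      · intro i j h
        exact evenOdd_isLowerTriangular B (k + m) ((Fin.strictMono_natAdd k) h)
    rw [h1, h2, mul_one]
  · intro i c h
    have := hc c h
    exact oddEven_isUpperTriangular B (k + m) (show c < Fin.natAdd k i from by
      rw [Fin.lt_def, Fin.val_natAdd]; omega)
  · intro c j h
    have := hc c h
    exact evenOdd_isLowerTriangular B (k + m) (show c < Fin.natAdd k j from by
      rw [Fin.lt_def, Fin.val_natAdd]; omega)

/-- The chain is: Hankel to top left minor of the power `p = n + 2m - 1`, Jacobi to a bottom right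
minor of the power `-p`, passage from `X Y` to `Y X` at the cost of one exponent, half-turn, and
back to a Hankel determinant. The starting exponent `-p + 1` equals `-n - 2(m - 1)`, hence the `2m`
on the left. -/
theorem hankel_reciprocity (k m : ℕ) [NeZero (k + m)] (n : ℤ) :
    (Matrix.of fun i j : Fin k => ((evenOdd B (k + m) * oddEven B (k + m)) ^
        (n + 2 * m - 1 + (i : ℕ) + (j : ℕ))) 0 0).det *
      ((∏ i : Fin m, descent (fun j => B (2 * ((k + m : ℕ) : ℤ) - j)) (2 * i)) *
        ∏ j : Fin m, B (2 * ((k + j : ℕ) : ℤ) + 1)) =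
    (∏ i : Fin k, descent B (2 * i)) *
      (∏ i : Fin (k + m), B (2 * (i : ℕ) + 1)) ^ (n + 2 * m - 1) *
      (Matrix.of fun i j : Fin m =>
        ((evenOdd (fun j => B (2 * ((k + m : ℕ) : ℤ) - j)) (k + m) *
          oddEven (fun j => B (2 * ((k + m : ℕ) : ℤ) - j)) (k + m)) ^
          (-n - (i : ℕ) - (j : ℕ))) 0 0).det := by
  have hu := isUnit_det_evenOdd_mul_oddEven (k + m) hB
  -- The exponents on the right decrease with `i` and `j`, while `det_hankel` wants them increasing;
  -- reversing rows and columns together leaves the determinant unchanged.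
  rw [det_of_rev (k := m)]
  have hr : (Matrix.of fun i j : Fin m =>
        ((evenOdd (fun j => B (2 * ((k + m : ℕ) : ℤ) - j)) (k + m) *
          oddEven (fun j => B (2 * ((k + m : ℕ) : ℤ) - j)) (k + m)) ^
          (-n - ((i.rev : Fin m) : ℕ) - ((j.rev : Fin m) : ℕ))) 0 0) =
      Matrix.of fun i j : Fin m =>
        ((evenOdd (fun j => B (2 * ((k + m : ℕ) : ℤ) - j)) (k + m) *
          oddEven (fun j => B (2 * ((k + m : ℕ) : ℤ) - j)) (k + m)) ^
          ((-(n + 2 * m - 1) + 1) + (i : ℕ) + (j : ℕ))) 0 0 := by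
    ext i j
    have h1 : ((i.rev : Fin m) : ℕ) = m - (i + 1) := Fin.val_rev i
    have h2 : ((j.rev : Fin m) : ℕ) = m - (j + 1) := Fin.val_rev j
    have hz : -n - ((i.rev : Fin m) : ℕ) - ((j.rev : Fin m) : ℕ) =
        (-(n + 2 * m - 1) + 1) + (i : ℕ) + (j : ℕ) := by omega
    rw [Matrix.of_apply, Matrix.of_apply, hz]
  rw [hr, det_hankel (k + m) (fun j => hB _) (Nat.le_add_left m k),
    det_hankel (k + m) hB (Nat.le_add_right k m), evenOdd_mul_oddEven_zpow_reflect]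
  have h3 : ((((oddEven B (k + m) * evenOdd B (k + m)) ^ (-(n + 2 * m - 1) + 1)).submatrix
      Fin.revPerm Fin.revPerm).transpose.submatrix (Fin.castLE (Nat.le_add_left m k))
        (Fin.castLE (Nat.le_add_left m k))).det =
      (((oddEven B (k + m) * evenOdd B (k + m)) ^ (-(n + 2 * m - 1) + 1)).submatrix
        (Fin.natAdd k : Fin m → Fin (k + m)) (Fin.natAdd k)).det := by
    rw [← Matrix.det_submatrix_equiv_self Fin.revPerm, ← Matrix.det_transpose]
    congr 1
    ext i j
    simp only [Matrix.transpose_apply, Matrix.submatrix_apply, Fin.revPerm_apply]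
    have hrev : ∀ l : Fin m,
        (Fin.castLE (Nat.le_add_left m k) l.rev).rev = Fin.natAdd k l := by
      intro l
      ext
      simp [Fin.val_rev]
      omega
    rw [hrev, hrev]
  have hne : ∀ (i : Fin k) (j : Fin m), Fin.castLE (Nat.le_add_right k m) i ≠ Fin.natAdd k j := by
    intro i j h
    rw [Fin.ext_iff] at h
    simp at h
    omega
  have hPQ : (evenOdd B (k + m) * oddEven B (k + m)) ^ (n + 2 * m - 1) *
      (evenOdd B (k + m) * oddEven B (k + m)) ^ (-(n + 2 * m - 1)) = 1 := by
    rw [← Matrix.zpow_add hu, add_neg_cancel, zpow_zero]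
  have hmono : StrictMono (Fin.castLE (Nat.le_add_right k m)) := fun i j h => h
  rw [h3, det_bottom_oddEven_mul_evenOdd_zpow hB,
    det_submatrix_complementary hmono hmono (Fin.strictMono_natAdd k) (Fin.strictMono_natAdd k)
      hne hne hPQ, det_zpow, det_evenOdd_mul_oddEven, Even.neg_one_pow]
  · ring
  · exact Finset.even_sum _ fun i _ => ⟨_, rfl⟩

theorem toeplitz_reciprocity (k m : ℕ) [NeZero (k + m)] (last : Fin (k + m))
    (hlast : (last : ℕ) + 1 = k + m) (n : ℤ) :
    (Matrix.of fun i j : Fin k => ((evenOdd B (k + m) * oddEven B (k + m)) ^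
        (n + j - i + (k + m - 1 : ℤ)) * evenOdd B (k + m)) 0 last).det =
    (-1) ^ (k * m) * (∏ i : Fin (k + m), B (2 * (i : ℕ) + 1)) ^ (n + m) *
      (Matrix.of fun i j : Fin m =>
        ((evenOdd (fun j => B (2 * ((k + m : ℕ) : ℤ) - j)) (k + m) *
          oddEven (fun j => B (2 * ((k + m : ℕ) : ℤ) - j)) (k + m)) ^
          (-n - j + i - 1) * evenOdd (fun j => B (2 * ((k + m : ℕ) : ℤ) - j)) (k + m))
            0 last).det := by
  have hu := isUnit_det_evenOdd_mul_oddEven (k + m) hB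
  rw [det_of_rev (k := k)]
  have hl : (Matrix.of fun i j : Fin k => ((evenOdd B (k + m) * oddEven B (k + m)) ^
        (n + ((j.rev : Fin k) : ℕ) - ((i.rev : Fin k) : ℕ) + (k + m - 1 : ℤ)) *
          evenOdd B (k + m)) 0 last) =
      Matrix.of fun i j : Fin k => ((evenOdd B (k + m) * oddEven B (k + m)) ^
        (n + m + (i : ℕ) + ((j.rev : Fin k) : ℕ)) * evenOdd B (k + m)) 0 last := by
    ext i j
    have h1 : ((i.rev : Fin k) : ℕ) = k - (i + 1) := Fin.val_rev i
    have hz : n + ((j.rev : Fin k) : ℕ) - ((i.rev : Fin k) : ℕ) + (k + m - 1 : ℤ) =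
        n + m + (i : ℕ) + ((j.rev : Fin k) : ℕ) := by omega
    rw [Matrix.of_apply, Matrix.of_apply, hz]
  have hr : (Matrix.of fun i j : Fin m =>
        ((evenOdd (fun j => B (2 * ((k + m : ℕ) : ℤ) - j)) (k + m) *
          oddEven (fun j => B (2 * ((k + m : ℕ) : ℤ) - j)) (k + m)) ^
          (-n - j + i - 1) * evenOdd (fun j => B (2 * ((k + m : ℕ) : ℤ) - j)) (k + m)) 0 last) =
      Matrix.of fun i j : Fin m => ((evenOdd B (k + m) * oddEven B (k + m)) ^
        (-(n + m) + (i : ℕ) + ((j.rev : Fin m) : ℕ)) * evenOdd B (k + m)) 0 last := by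
    ext i j
    have h1 : ((j.rev : Fin m) : ℕ) = m - (j + 1) := Fin.val_rev j
    have hz : -n - (j : ℕ) + (i : ℕ) - 1 =
        -(n + m) + (i : ℕ) + ((j.rev : Fin m) : ℕ) := by omega
    rw [Matrix.of_apply, Matrix.of_apply, evenOdd_mul_oddEven_zpow_mul_reflect B (k + m) hB,
      Matrix.transpose_apply, Matrix.submatrix_apply]
    -- The half-turn followed by transposition fixes the corner `(0, last)`, so the reflected
    -- weights give the same generating function here.
    have h2 : Fin.revPerm last = 0 := by
      ext
      simp [Fin.val_rev]
      omega
    have h3 : Fin.revPerm (0 : Fin (k + m)) = last := by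
      ext
      simp [Fin.val_rev]
      omega
    rw [h2, h3, hz]
  rw [hl, hr, det_toeplitz (k + m) hB (Nat.add_comm k m) _ last hlast,
    det_toeplitz (k + m) hB rfl _ last hlast]
  have hPQ : (evenOdd B (k + m) * oddEven B (k + m)) ^ (n + m) * evenOdd B (k + m) *
      (oddEven B (k + m) * (evenOdd B (k + m) * oddEven B (k + m)) ^ (-(n + m) - 1)) = 1 := by
    rw [Matrix.mul_assoc, ← Matrix.mul_assoc (evenOdd B (k + m)), ← Matrix.zpow_one_add hu,
      ← Matrix.zpow_add hu]
    rw [show n + m + (1 + (-(n + m) - 1)) = 0 by ring, zpow_zero]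
  rw [det_submatrix_complementary (r' := fun j : Fin m => ⟨k + j, by omega⟩)
    (s' := fun j : Fin m => ⟨j, by omega⟩) (fun i j h => h)
    (fun i j h => Nat.add_lt_add_left h m) (fun i j h => Nat.add_lt_add_left h k)
    (fun i j h => h) (fun i j h => by rw [Fin.ext_iff] at h; simp at h; omega)
    (fun i j h => by rw [Fin.ext_iff] at h; simp at h; omega) hPQ,
    Matrix.det_mul, det_zpow, det_evenOdd_mul_oddEven, det_evenOdd, mul_one]
  -- Row `i` is paired with column `m + i`, so each of the `k` summands contributes the parity of
  -- `m`.
  have hsign : (-1 : K) ^ (∑ i : Fin k, ((i : ℕ) + (m + i))) = (-1) ^ (k * m) := by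
    have : ∑ i : Fin k, ((i : ℕ) + (m + i)) = k * m + 2 * ∑ i : Fin k, (i : ℕ) := by
      simp only [Finset.sum_add_distrib, Finset.sum_const, Finset.card_univ, Fintype.card_fin,
        smul_eq_mul]
      ring
    rw [this, pow_add, pow_mul (-1 : K) 2]
    simp
  rw [hsign]
  congr 1
  -- Jacobi leaves a top right minor of the inverse. Multiplying by the lower unitriangular
  -- `evenOdd` on both sides does not change it and restores the form required by `det_toeplitz`.
  have e : (evenOdd B (k + m) * oddEven B (k + m)) ^ (-(n + m)) * evenOdd B (k + m) =
      evenOdd B (k + m) *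
        (oddEven B (k + m) * (evenOdd B (k + m) * oddEven B (k + m)) ^ (-(n + m) - 1)) *
        evenOdd B (k + m) := by
    rw [← Matrix.mul_assoc (evenOdd B (k + m)), ← Matrix.zpow_one_add hu]
    congr 2
    ring
  have e2 : ((evenOdd B (k + m) * oddEven B (k + m)) ^ (-(n + m)) * evenOdd B (k + m)).submatrix
        (fun j : Fin m => (⟨j, by omega⟩ : Fin (k + m)))
        (fun j : Fin m => (⟨k + j, by omega⟩ : Fin (k + m))) =
      (evenOdd B (k + m)).submatrix (fun j : Fin m => (⟨j, by omega⟩ : Fin (k + m))) id *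
        (oddEven B (k + m) * (evenOdd B (k + m) * oddEven B (k + m)) ^ (-(n + m) - 1)) *
        (evenOdd B (k + m)).submatrix id (fun j : Fin m => (⟨k + j, by omega⟩ : Fin (k + m))) := by
    rw [e]
    ext i j
    simp only [Matrix.mul_apply, Matrix.submatrix_apply, id]
  rw [e2, det_mul_mul_of_support _ (f := fun j : Fin m => (⟨j, by omega⟩ : Fin (k + m)))
    (g := fun j : Fin m => (⟨k + j, by omega⟩ : Fin (k + m)))]
  · have h1 : (((evenOdd B (k + m)).submatrix (fun j : Fin m => (⟨j, by omega⟩ : Fin (k + m)))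
        id).submatrix id (fun j : Fin m => (⟨j, by omega⟩ : Fin (k + m)))).det = 1 := by
      rw [Matrix.det_of_isLowerTriangular]
      · refine Finset.prod_eq_one fun i _ => ?_
        simp only [Matrix.submatrix_apply, id, evenOdd_diag]
      · intro i j h
        exact evenOdd_isLowerTriangular B (k + m) (show (⟨i, _⟩ : Fin (k + m)) < ⟨j, _⟩ from h)
    have h2 : (((evenOdd B (k + m)).submatrix id
        (fun j : Fin m => (⟨k + j, by omega⟩ : Fin (k + m)))).submatrix
        (fun j : Fin m => (⟨k + j, by omega⟩ : Fin (k + m))) id).det = 1 := by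
      rw [Matrix.det_of_isLowerTriangular]
      · refine Finset.prod_eq_one fun i _ => ?_
        simp only [Matrix.submatrix_apply, id, evenOdd_diag]
      · intro i j h
        exact evenOdd_isLowerTriangular B (k + m)
          (show (⟨k + i, _⟩ : Fin (k + m)) < ⟨k + j, _⟩ from Nat.add_lt_add_left h k)
    rw [h1, h2, one_mul, mul_one]
  · intro i j h
    simpa [Fin.ext_iff] using h
  · intro i j h
    simpa [Fin.ext_iff] using h
  · intro i c hc
    have : m ≤ (c : ℕ) := by
      by_contra! h
      exact hc ⟨⟨c, h⟩, rfl⟩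
    exact evenOdd_isLowerTriangular B (k + m) (show (⟨i, _⟩ : Fin (k + m)) < c from by
      rw [Fin.lt_def]; simp; omega)
  · intro c j hc
    have : (c : ℕ) < k := by
      by_contra! h
      exact hc ⟨⟨c - k, by omega⟩, Fin.ext (by simp; omega)⟩
    exact evenOdd_isLowerTriangular B (k + m) (show c < (⟨k + j, _⟩ : Fin (k + m)) from by
      rw [Fin.lt_def]; simp; omega)

end Reciprocity

/-! ### The prefactors in the variables `A` and `V` -/

section SubstAV

variable {K : Type*} [Field K]

theorem substAV_odd (A V : ℤ → K) (i : ℤ) :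
    substAV A V (2 * i + 1) = (A (i + 1))⁻¹ * (V (i + 1))⁻¹ := by
  rw [substAV, if_pos ⟨i, rfl⟩, show (2 * i + 1 + 1) / 2 = i + 1 by omega]

theorem substAV_even (A V : ℤ → K) (i : ℤ) :
    substAV A V (2 * i) = (A i)⁻¹ * (V (i + 1))⁻¹ := by
  rw [substAV, if_neg (by simp), show 2 * i / 2 = i by omega]

theorem substAV_reflect (A V : ℤ → K) (N : ℤ) :
    substAV (fun i => V (N + 1 - i)) (fun i => A (N + 1 - i)) =
      fun j => substAV A V (2 * N - j) := by
  funext j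
  rcases Int.even_or_odd' j with ⟨i, rfl | rfl⟩
  · rw [show 2 * N - 2 * i = 2 * (N - i) by ring, substAV_even, substAV_even, mul_comm]
    congr 3 <;> ring
  · rw [show 2 * N - (2 * i + 1) = 2 * (N - i - 1) + 1 by ring, substAV_odd, substAV_odd, mul_comm]
    congr 3 <;> ring

theorem prod_Icc_eq_prod_range {M : Type*} [CommMonoid M] (N : ℕ) (f : ℤ → M) :
    ∏ i ∈ Finset.Icc (1 : ℤ) N, f i = ∏ x ∈ Finset.range N, f (x + 1) := by
  refine (Finset.prod_bij' (fun (x : ℕ) _ => (x : ℤ) + 1) (fun i _ => (i - 1).toNat)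
    ?_ ?_ ?_ ?_ ?_).symm
  · intro x hx
    simp only [Finset.mem_range, Finset.mem_Icc] at hx ⊢
    omega
  · intro x hx
    simp only [Finset.mem_range, Finset.mem_Icc] at hx ⊢
    omega
  · intro x hx
    omega
  · intro x hx
    simp only [Finset.mem_Icc] at hx
    omega
  · intro x hx
    rfl

/-- The extended product telescopes in either direction. The relation is only asked for `i ≥ 1`
because the `g` used below contains `(i - 1).toNat`, which truncates for smaller `i`. -/
theorem extProd_eq_div {f g : ℤ → K} (hg : ∀ i, g i ≠ 0)
    (h : ∀ i, 1 ≤ i → g (i + 1) = f i * g i) {R S : ℤ} (hR : 1 ≤ R) (hS : 1 ≤ S) :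
    extProd R S f = g S / g R := by
  have key : ∀ R S : ℤ, 1 ≤ R → R ≤ S → ∏ i ∈ Finset.Ico R S, f i = g S / g R := by
    intro R S hR hRS
    induction S, hRS using Int.leInduction with
    | base => rw [Finset.Ico_self, Finset.prod_empty, div_self (hg R)]
    | succ S hRS ih =>
      have : Finset.Ico R (S + 1) = insert S (Finset.Ico R S) := by
        ext x
        simp only [Finset.mem_Ico, Finset.mem_insert]
        omega
      rw [this, Finset.prod_insert (by simp), ih, h S (by omega)]
      ring
  unfold extProd
  split_ifs with h1 h2
  · exact key R S hR h1.le
  · rw [h2, div_self (hg S)]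
  · rw [Finset.prod_inv_distrib, key S R hS (by omega), inv_div]

variable {A V : ℤ → K} (hA : ∀ i, A i ≠ 0) (hV : ∀ i, V i ≠ 0)

include hA hV

theorem substAV_ne_zero (j : ℤ) : substAV A V j ≠ 0 := by
  unfold substAV
  split_ifs <;> exact mul_ne_zero (inv_ne_zero (hA _)) (inv_ne_zero (hV _))

theorem descent_substAV_succ (x : ℕ) :
    descent (substAV A V) (2 * (x + 1)) * V (x + 2) =
      (A (x + 1) ^ (-2 : ℤ) * V (x + 1) ^ (-2 : ℤ)) * (descent (substAV A V) (2 * x) * V (x + 1)) := by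
  have h1 := substAV_odd A V x
  have h2 := substAV_even A V (x + 1)
  rw [descent, show 2 * (x + 1) = 2 * x + 1 + 1 by ring, Finset.prod_range_succ,
    Finset.prod_range_succ, ← descent]
  push_cast
  rw [h1, show (2 * (x : ℤ) + 1 + 1) = 2 * (x + 1) by ring, h2,
    show (x : ℤ) + 1 + 1 = x + 2 by ring]
  have := hA (x + 1)
  have := hV (x + 1)
  have := hV (x + 2)
  field_simp

omit hA hV in
theorem descent_substAV_odd (x : ℕ) :
    descent (substAV A V) (2 * x + 1) =
      descent (substAV A V) (2 * x) * (A (x + 1))⁻¹ * (V (x + 1))⁻¹ := by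
  rw [descent, Finset.prod_range_succ, ← descent]
  push_cast
  rw [substAV_odd, mul_assoc]

theorem extProd_inv_substAV {R S : ℤ} (hR : 1 ≤ R) (hS : 1 ≤ S) :
    extProd R S (fun i => A i ^ (-2 : ℤ) * V i ^ (-2 : ℤ)) =
      (descent (substAV A V) (2 * (S - 1).toNat) * V S) /
        (descent (substAV A V) (2 * (R - 1).toNat) * V R) := by
  refine extProd_eq_div (g := fun i => descent (substAV A V) (2 * (i - 1).toNat) * V i) ?_ ?_ hR hS
  · exact fun i => mul_ne_zero (descent_ne_zero (substAV_ne_zero hA hV) _) (hV i)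
  · intro i hi
    obtain ⟨x, rfl⟩ : ∃ x : ℕ, i = x + 1 := ⟨(i - 1).toNat, by omega⟩
    have := descent_substAV_succ hA hV x
    rw [show ((x : ℤ) + 1 + 1 - 1).toNat = x + 1 by omega,
      show ((x : ℤ) + 1 - 1).toNat = x by omega, show (x : ℤ) + 1 + 1 = x + 2 by ring, this]

omit hA hV in
theorem extProd_inv_eq_inv (R S : ℤ) :
    extProd R S (fun i => A i ^ 2 * V i ^ 2) =
      (extProd R S (fun i => A i ^ (-2 : ℤ) * V i ^ (-2 : ℤ)))⁻¹ := by
  have : ∀ i, A i ^ 2 * V i ^ 2 = (A i ^ (-2 : ℤ) * V i ^ (-2 : ℤ))⁻¹ := by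
    intro i
    rw [mul_inv, zpow_neg, zpow_neg, inv_inv, inv_inv, zpow_ofNat, zpow_ofNat]
  unfold extProd
  simp only [this]
  split_ifs
  · rw [Finset.prod_inv_distrib]
  · rw [inv_one]
  · rw [Finset.prod_inv_distrib]

theorem even_factor (x y : ℕ) :
    V (x + 1) * (V (y + 1))⁻¹ *
      extProd (x + 1) (y + 1) (fun i => A i ^ (-2 : ℤ) * V i ^ (-2 : ℤ)) =
      descent (substAV A V) (2 * y) / descent (substAV A V) (2 * x) := by
  rw [extProd_inv_substAV hA hV (by omega) (by omega), show ((x : ℤ) + 1 - 1).toNat = x by omega,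
    show ((y : ℤ) + 1 - 1).toNat = y by omega]
  have := hV (x + 1)
  have := hV (y + 1)
  have := descent_ne_zero (substAV_ne_zero hA hV) (2 * x)
  field_simp

theorem odd_factor (x y : ℕ) :
    A (x + 1) ^ (-2 : ℤ) * (V (x + 1))⁻¹ * A (y + 1) *
      extProd (x + 1 + 1) (y + 1 + 1) (fun i => A i ^ (-2 : ℤ) * V i ^ (-2 : ℤ)) =
      descent (substAV A V) (2 * y + 1) / descent (substAV A V) (2 * x) := by
  rw [extProd_inv_substAV hA hV (by omega) (by omega),
    show ((x : ℤ) + 1 + 1 - 1).toNat = x + 1 by omega,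
    show ((y : ℤ) + 1 + 1 - 1).toNat = y + 1 by omega, show (x : ℤ) + 1 + 1 = x + 2 by ring,
    show (y : ℤ) + 1 + 1 = y + 2 by ring, descent_substAV_succ hA hV, descent_substAV_succ hA hV,
    descent_substAV_odd]
  have := hV (x + 1)
  have := hV (y + 1)
  have := hA (x + 1)
  have := hA (y + 1)
  have := descent_ne_zero (substAV_ne_zero hA hV) (2 * x)
  field_simp

theorem even_factor' (x y : ℕ) :
    V (y + 1) * (V (x + 1))⁻¹ * extProd (x + 1) (y + 1) (fun i => A i ^ 2 * V i ^ 2) =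
      descent (substAV A V) (2 * x) / descent (substAV A V) (2 * y) := by
  rw [extProd_inv_eq_inv, ← inv_div, ← even_factor hA hV]
  simp only [mul_inv, inv_inv]
  ring

theorem odd_factor' (x y : ℕ) :
    A (x + 1) ^ 2 * V (x + 1) * (A (y + 1))⁻¹ *
      extProd (x + 1 + 1) (y + 1 + 1) (fun i => A i ^ 2 * V i ^ 2) =
      descent (substAV A V) (2 * x) / descent (substAV A V) (2 * y + 1) := by
  rw [extProd_inv_eq_inv, ← inv_div, ← odd_factor hA hV]
  simp only [mul_inv, inv_inv, zpow_neg, zpow_ofNat]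

omit hA hV in
theorem prod_substAV_zpow (N : ℕ) (z : ℤ) :
    (∏ i : Fin N, substAV A V (2 * (i : ℕ) + 1)) ^ z =
      ∏ i ∈ Finset.Icc (1 : ℤ) N, (A i ^ (-z) * V i ^ (-z)) := by
  rw [prod_Icc_eq_prod_range, Finset.prod_range, ← Finset.prod_zpow]
  refine Finset.prod_congr rfl fun i _ => ?_
  rw [substAV_odd, mul_zpow, inv_zpow, inv_zpow, zpow_neg, zpow_neg]

theorem prod_descent_substAV (k : ℕ) :
    ∏ i ∈ Finset.range k, descent (substAV A V) (2 * i) =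
      V 1 ^ k * ∏ x ∈ Finset.range k, ((V (x + 1))⁻¹ *
        (A (x + 1) * V (x + 1)) ^ (-2 * ((k : ℤ) - 1 - x))) := by
  -- In the product over `i < k`, the factor indexed by `x` occurs once for every `i` with `x < i <
  -- k`, that is, `k - 1 - x` times.
  have hd : ∀ i : ℕ, descent (substAV A V) (2 * i) = V 1 * (V (i + 1))⁻¹ *
      ∏ x ∈ Finset.range i, (A (x + 1) * V (x + 1)) ^ (-2 : ℤ) := by
    intro i
    induction i with
    | zero => simp [descent, hV 1]
    | succ i ih =>
      have := descent_substAV_succ hA hV i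
      have h2 := hV (i + 2)
      rw [← eq_div_iff h2] at this
      rw [this, ih, Finset.prod_range_succ, mul_zpow (A (i + 1))]
      push_cast
      rw [show (i : ℤ) + 1 + 1 = i + 2 by ring]
      have := hV (i + 1)
      field_simp
  induction k with
  | zero => simp
  | succ k ih =>
    rw [Finset.prod_range_succ, ih, hd, Finset.prod_range_succ]
    have : ∏ x ∈ Finset.range k, ((V (x + 1))⁻¹ *
        (A (x + 1) * V (x + 1)) ^ (-2 * (((k + 1 : ℕ) : ℤ) - 1 - x))) =
        (∏ x ∈ Finset.range k, ((V (x + 1))⁻¹ *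
          (A (x + 1) * V (x + 1)) ^ (-2 * ((k : ℤ) - 1 - x)))) *
          ∏ x ∈ Finset.range k, (A (x + 1) * V (x + 1)) ^ (-2 : ℤ) := by
      rw [← Finset.prod_mul_distrib]
      refine Finset.prod_congr rfl fun x _ => ?_
      rw [mul_assoc, ← zpow_add₀ (mul_ne_zero (hA _) (hV _))]
      congr 2
      push_cast
      ring
    have h0 : -2 * (((k + 1 : ℕ) : ℤ) - 1 - k) = 0 := by push_cast; ring
    rw [this, h0, zpow_zero]
    ring

/-- This compares the factors of `hankel_reciprocity` with the closed form of (a). The reflected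
descents contribute `A (k + m) ^ m`, the reflection of `V 1 ^ m`, which accounts for `A (k + m) ^
(-m)`. -/
theorem hankel_factor (n : ℤ) (k m : ℕ) :
    (∏ i : Fin k, descent (substAV A V) (2 * i)) *
      (∏ i : Fin (k + m), substAV A V (2 * (i : ℕ) + 1)) ^ (n + 2 * m - 1) =
    (V 1 ^ k * (A (k + m)) ^ (-(m : ℤ)) *
        ∏ i ∈ Finset.Icc (1 : ℤ) (k + m),
          (A i ^ (-(n + 2 * m + 2 * k - 2 * i - 1)) *
            V i ^ (-(n + 2 * m + 2 * k - 2 * i)))) *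
    ((∏ i : Fin m, descent (fun j => substAV A V (2 * ((k + m : ℕ) : ℤ) - j)) (2 * i)) *
        ∏ j : Fin m, substAV A V (2 * ((k + j : ℕ) : ℤ) + 1)) := by
  have h1 := prod_descent_substAV (A := fun i => V (((k + m : ℕ) : ℤ) + 1 - i))
    (V := fun i => A (((k + m : ℕ) : ℤ) + 1 - i)) (fun i => hV _) (fun i => hA _) m
  rw [substAV_reflect] at h1
  have h2 : ∏ x ∈ Finset.range m, ((A (((k + m : ℕ) : ℤ) + 1 - ((x : ℤ) + 1)))⁻¹ *
      (V (((k + m : ℕ) : ℤ) + 1 - ((x : ℤ) + 1)) * A (((k + m : ℕ) : ℤ) + 1 - ((x : ℤ) + 1))) ^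
          (-2 * ((m : ℤ) - 1 - x))) =
      ∏ x ∈ Finset.range m, ((A (k + x + 1))⁻¹ *
        (A (k + x + 1) * V (k + x + 1)) ^ (-2 * (x : ℤ))) := by
    rw [← Finset.prod_range_reflect]
    refine Finset.prod_congr rfl fun x hx => ?_
    rw [Finset.mem_range] at hx
    rw [show ((k + m : ℕ) : ℤ) + 1 - (((m - 1 - x : ℕ) : ℤ) + 1) = k + x + 1 by omega,
      show (m : ℤ) - 1 - ((m - 1 - x : ℕ) : ℤ) = x by omega, mul_comm (V _)]
  rw [h2, show ((k + m : ℕ) : ℤ) + 1 - 1 = k + m by push_cast; ring] at h1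
  rw [← Finset.prod_range (fun i => descent (substAV A V) (2 * i)), prod_descent_substAV hA hV,
    prod_substAV_zpow,
    ← Finset.prod_range
      (fun i => descent (fun j => substAV A V (2 * ((k + m : ℕ) : ℤ) - j)) (2 * i)), h1,
    ← Finset.prod_range (fun j => substAV A V (2 * ((k + j : ℕ) : ℤ) + 1))]
  rw [show (k : ℤ) + m = ((k + m : ℕ) : ℤ) by push_cast; rfl, prod_Icc_eq_prod_range,
    prod_Icc_eq_prod_range, Finset.prod_range_add, Finset.prod_range_add]
  -- For the first `k` indices the exponents combine the determinant with the descents of the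
  -- left-hand minor.
  have e1 : ∏ x ∈ Finset.range k, (A ((x : ℤ) + 1) ^ (-(n + 2 * m + 2 * k - 2 * ((x : ℤ) + 1) - 1)) *
        V ((x : ℤ) + 1) ^ (-(n + 2 * m + 2 * k - 2 * ((x : ℤ) + 1)))) =
      (∏ x ∈ Finset.range k, ((V (x + 1))⁻¹ *
        (A (x + 1) * V (x + 1)) ^ (-2 * ((k : ℤ) - 1 - x)))) *
      ∏ x ∈ Finset.range k, (A ((x : ℤ) + 1) ^ (-(n + 2 * m - 1)) *
        V ((x : ℤ) + 1) ^ (-(n + 2 * m - 1))) := by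
    rw [← Finset.prod_mul_distrib]
    refine Finset.prod_congr rfl fun x _ => ?_
    rw [mul_zpow, ← zpow_neg_one]
    rw [show -(n + 2 * m + 2 * k - 2 * ((x : ℤ) + 1) - 1) =
        -2 * ((k : ℤ) - 1 - x) + (-(n + 2 * m - 1)) by ring,
      show -(n + 2 * m + 2 * k - 2 * ((x : ℤ) + 1)) =
        -1 + -2 * ((k : ℤ) - 1 - x) + (-(n + 2 * m - 1)) by ring,
      zpow_add₀ (hA _), zpow_add₀ (hV _), zpow_add₀ (hV _)]
    ring
  -- For the last `m` indices the reflected descents and the diagonal of `oddEven` cancel everything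
  -- except the determinant.
  have e2 : (∏ x ∈ Finset.range m,
        (A (((k + x : ℕ) : ℤ) + 1) ^ (-(n + 2 * m + 2 * k - 2 * (((k + x : ℕ) : ℤ) + 1) - 1)) *
        V (((k + x : ℕ) : ℤ) + 1) ^ (-(n + 2 * m + 2 * k - 2 * (((k + x : ℕ) : ℤ) + 1))))) *
      ((∏ x ∈ Finset.range m, ((A (k + x + 1))⁻¹ *
        (A (k + x + 1) * V (k + x + 1)) ^ (-2 * (x : ℤ)))) *
        ∏ x ∈ Finset.range m, substAV A V (2 * ((k + x : ℕ) : ℤ) + 1)) =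
      ∏ x ∈ Finset.range m, (A (((k + x : ℕ) : ℤ) + 1) ^ (-(n + 2 * m - 1)) *
        V (((k + x : ℕ) : ℤ) + 1) ^ (-(n + 2 * m - 1))) := by
    rw [← Finset.prod_mul_distrib, ← Finset.prod_mul_distrib]
    refine Finset.prod_congr rfl fun x _ => ?_
    rw [substAV_odd, mul_zpow, ← zpow_neg_one, ← zpow_neg_one, ← zpow_neg_one]
    push_cast
    rw [show -(n + 2 * m + 2 * k - 2 * ((k : ℤ) + x + 1) - 1) =
        -(n + 2 * m - 1) + 1 + 1 + 2 * (x : ℤ) by ring,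
      show -(n + 2 * m + 2 * k - 2 * ((k : ℤ) + x + 1)) =
        -(n + 2 * m - 1) + 1 + 2 * (x : ℤ) by ring,
      zpow_add₀ (hA _), zpow_add₀ (hA _), zpow_add₀ (hA _), zpow_add₀ (hV _), zpow_add₀ (hV _),
      zpow_one, zpow_one, show -2 * (x : ℤ) = -(2 * x) by ring, zpow_neg _ (2 * (x : ℤ)),
      zpow_neg _ (2 * (x : ℤ)), zpow_neg_one, zpow_neg_one]
    have a1 := hA (k + x + 1)
    have v1 := hV (k + x + 1)
    have a2 := zpow_ne_zero (2 * (x : ℤ)) a1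
    have v2 := zpow_ne_zero (2 * (x : ℤ)) v1
    generalize A (k + x + 1) ^ (-(n + 2 * m - 1)) = a3
    generalize V (k + x + 1) ^ (-(n + 2 * m - 1)) = v3
    generalize A (k + x + 1) ^ (2 * (x : ℤ)) = a4 at *
    generalize V (k + x + 1) ^ (2 * (x : ℤ)) = v4 at *
    field_simp
  rw [e1, ← e2, zpow_neg, zpow_natCast]
  have aN := pow_ne_zero m (hA ((k + m : ℕ) : ℤ))
  field_simp

end SubstAV

/-! ### Parts (a) to (d) in terms of path generating functions -/

section Statements

variable {K : Type*} [Field K]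

theorem wBAV_reflect (A V : ℤ → K) (N : ℤ) :
    wBAV (fun i => V (N + 1 - i)) (fun i => A (N + 1 - i)) =
      wB (fun j => substAV A V (2 * N - j)) := by
  funext n p
  rw [wBAV, substAV_reflect]

theorem pathGF_zero_zero {B : ℤ → K} (hB : ∀ j, B j ≠ 0) (N : ℕ) [NeZero N] (z : ℤ) :
    pathGF (2 * (N : ℤ) - 1) (wB B) 0 0 (2 * z) = ((evenOdd B N * oddEven B N) ^ z) 0 0 := by
  have := pathGF_even N hB 0 0 z
  simpa using this

theorem topGF_eq {B : ℤ → K} (hB : ∀ j, B j ≠ 0) (N : ℕ) [NeZero N] (last : Fin N)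
    (hlast : (last : ℕ) + 1 = N) (z : ℤ) :
    topGF (2 * (N : ℤ) - 1) (wB B) (2 * z) =
      ((evenOdd B N * oddEven B N) ^ (z + N - 1) * evenOdd B N) 0 last := by
  have := pathGF_odd N hB 0 last (z + N - 1)
  rw [topGF, ← this]
  congr 1
  · omega
  · ring

/-- Kept for general weights `B`, since both (a) and the area statement (e) specialise it. -/
theorem hankel_pathGF_eq {B : ℤ → K} (hB : ∀ j, B j ≠ 0) (n k m : ℕ) [NeZero (k + m)] :
    (Matrix.of fun i j : Fin k => pathGF (2 * k + 2 * m - 1) (wB B) 0 0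
          (2 * n + 2 * i + 2 * j + 4 * m - 2)).det *
      ((∏ i : Fin m, descent (fun j => B (2 * ((k + m : ℕ) : ℤ) - j)) (2 * i)) *
        ∏ j : Fin m, B (2 * ((k + j : ℕ) : ℤ) + 1)) =
    (∏ i : Fin k, descent B (2 * i)) *
      (∏ i : Fin (k + m), B (2 * (i : ℕ) + 1)) ^ ((n : ℤ) + 2 * m - 1) *
      (Matrix.of fun i j : Fin m =>
        pathGF (2 * k + 2 * m - 1) (wB fun j => B (2 * ((k + m : ℕ) : ℤ) - j)) 0 0
          (-2 * n - 2 * i - 2 * j)).det := by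
  have hN : (2 * k + 2 * m - 1 : ℤ) = 2 * ((k + m : ℕ) : ℤ) - 1 := by push_cast; ring
  have e1 : ∀ i j : ℕ, (2 * n + 2 * i + 2 * j + 4 * m - 2 : ℤ) =
      2 * ((n : ℤ) + 2 * m - 1 + i + j) := fun i j => by ring
  have e2 : ∀ i j : ℕ, (-2 * n - 2 * i - 2 * j : ℤ) = 2 * (-(n : ℤ) - i - j) := fun i j => by ring
  simp only [hN, e1, e2, pathGF_zero_zero hB, pathGF_zero_zero (fun _ => hB _)]
  exact hankel_reciprocity hB k m n

variable {A V : ℤ → K} (hA : ∀ i, A i ≠ 0) (hV : ∀ i, V i ≠ 0)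
include hA hV

theorem hankel_substAV_reciprocity (n k m : ℕ) :
      Matrix.det (Matrix.of fun i j : Fin k =>
        pathGF (2 * k + 2 * m - 1) (wBAV A V) 0 0
          (2 * n + 2 * i + 2 * j + 4 * m - 2)) =
      (V 1 ^ k * (A (k + m)) ^ (-(m : ℤ)) *
        ∏ i ∈ Finset.Icc (1 : ℤ) (k + m),
          (A i ^ (-((n : ℤ) + 2 * m + 2 * k - 2 * i - 1)) *
            V i ^ (-((n : ℤ) + 2 * m + 2 * k - 2 * i)))) *
      Matrix.det (Matrix.of fun i j : Fin m =>
        RAV (k + m) (fun A' V' =>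
          pathGF (2 * k + 2 * m - 1) (wBAV A' V') 0 0
            (-2 * n - 2 * i - 2 * j)) A V) := by
  rcases Nat.eq_zero_or_pos (k + m) with h0 | h0
  · obtain ⟨rfl, rfl⟩ : k = 0 ∧ m = 0 := by omega
    simp
  have : NeZero (k + m) := ⟨h0.ne'⟩
  have hB := substAV_ne_zero hA hV
  have h := hankel_pathGF_eq hB n k m
  rw [hankel_factor hA hV] at h
  have hne : ((∏ i : Fin m, descent (fun j => substAV A V (2 * ((k + m : ℕ) : ℤ) - j)) (2 * i)) *
        ∏ j : Fin m, substAV A V (2 * ((k + j : ℕ) : ℤ) + 1)) ≠ 0 :=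
    mul_ne_zero (Finset.prod_ne_zero_iff.2 fun _ _ => descent_ne_zero (fun _ => hB _) _)
      (Finset.prod_ne_zero_iff.2 fun _ _ => hB _)
  refine mul_right_cancel₀ hne (h.trans ?_)
  simp only [RAV, wBAV_reflect]
  push_cast
  ring

theorem toeplitz_substAV_reciprocity (n k m : ℕ) (hk : 0 < k) :
      Matrix.det (Matrix.of fun i j : Fin k =>
        topGF (2 * k + 2 * m - 1) (wBAV A V) (2 * n + 2 * j - 2 * i)) =
      (-1) ^ (k * m) *
      (∏ i ∈ Finset.Icc (1 : ℤ) (k + m), (A i ^ (-(n : ℤ) - m) * V i ^ (-(n : ℤ) - m))) *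
      Matrix.det (Matrix.of fun i j : Fin m =>
        RAV (k + m) (fun A' V' =>
          topGF (2 * k + 2 * m - 1) (wBAV A' V')
            (-2 * n - 2 * j + 2 * i - 2 * k - 2 * m)) A V) := by
  have : NeZero (k + m) := ⟨by omega⟩
  have hB := substAV_ne_zero hA hV
  have h := toeplitz_reciprocity hB k m ⟨k + m - 1, by omega⟩ (by simp; omega) n
  have hp := prod_substAV_zpow (A := A) (V := V) (k + m) ((n : ℤ) + m)
  rw [hp] at h
  have hN : (2 * k + 2 * m - 1 : ℤ) = 2 * ((k + m : ℕ) : ℤ) - 1 := by push_cast; ring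
  have e1 : ∀ i j : ℕ, (2 * n + 2 * j - 2 * i : ℤ) = 2 * ((n : ℤ) + j - i) := fun i j => by ring
  have e2 : ∀ i j : ℕ, (-2 * n - 2 * j + 2 * i - 2 * k - 2 * m : ℤ) =
      2 * (-(n : ℤ) - j + i - k - m) := fun i j => by ring
  have hw : wBAV A V = wB (substAV A V) := rfl
  simp only [RAV, wBAV_reflect, hw]
  rw [show (k : ℤ) + m = ((k + m : ℕ) : ℤ) by push_cast; rfl]
  simp only [hN, e1, e2]
  simp only [topGF_eq hB (k + m) ⟨k + m - 1, by omega⟩ (by simp; omega),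
    topGF_eq (B := fun j => substAV A V (2 * ((k + m : ℕ) : ℤ) - j)) (fun _ => hB _)
      (k + m) ⟨k + m - 1, by omega⟩ (by simp; omega)]
  have e3 : ∀ i j : ℕ, (n : ℤ) + j - i + ((k + m : ℕ) : ℤ) - 1 = n + j - i + (k + m - 1 : ℤ) :=
    fun i j => by push_cast; ring
  have e4 : ∀ i j : ℕ, -(n : ℤ) - j + i - k - m + ((k + m : ℕ) : ℤ) - 1 = -n - j + i - 1 :=
    fun i j => by push_cast; ring
  have e5 : -((n : ℤ) + m) = -(n : ℤ) - m := by ring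
  simp only [e3, e4]
  rw [e5] at h
  exact h

theorem minors_substAV_reciprocity (k m : ℕ) (r s : Fin k → ℤ) (r' s' : Fin m → ℤ)
    (hr : StrictMono r) (hs : StrictMono s)
    (hrb : ∀ i, 1 ≤ r i ∧ r i ≤ k + m) (hsb : ∀ i, 1 ≤ s i ∧ s i ≤ k + m)
    (hr' : StrictMono r') (hs' : StrictMono s')
    (hrr : Set.range r' = Set.Icc (1 : ℤ) (k + m) \ Set.range r)
    (hss : Set.range s' = Set.Icc (1 : ℤ) (k + m) \ Set.range s) :
      (∀ n : ℕ,
        Matrix.det (Matrix.of fun i j : Fin k =>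
          pathGF (2 * k + 2 * m - 1) (wBAV A V) (2 * r i - 2) (2 * s j - 2) (2 * n)) =
        (-1) ^ (∑ i, (r i + s i)) *
        (∏ i ∈ Finset.Icc (1 : ℤ) (k + m), (A i ^ (-(n : ℤ)) * V i ^ (-(n : ℤ)))) *
        (∏ j, (V (s j) * (V (r j))⁻¹ *
          extProd (r j) (s j) (fun i => A i ^ 2 * V i ^ 2))) *
        Matrix.det (Matrix.of fun i j : Fin m =>
          pathGF (2 * k + 2 * m - 1) (wBAV A V) (2 * r' i - 2) (2 * s' j - 2) (-2 * n)) ∧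
        Matrix.det (Matrix.of fun i j : Fin k =>
          pathGF (2 * k + 2 * m - 1) (wBAV A V) (2 * r i - 2) (2 * s j - 2) (2 * n)) =
        (-1) ^ (∑ i, (r' i + s' i)) *
        (∏ i ∈ Finset.Icc (1 : ℤ) (k + m), (A i ^ (-(n : ℤ)) * V i ^ (-(n : ℤ)))) *
        (∏ j, (V (r' j) * (V (s' j))⁻¹ *
          extProd (r' j) (s' j) (fun i => A i ^ (-2 : ℤ) * V i ^ (-2 : ℤ)))) *
        Matrix.det (Matrix.of fun i j : Fin m =>
          pathGF (2 * k + 2 * m - 1) (wBAV A V) (2 * r' i - 2) (2 * s' j - 2) (-2 * n))) ∧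
      (∀ n : ℕ, 0 < n →
        Matrix.det (Matrix.of fun i j : Fin k =>
          pathGF (2 * k + 2 * m - 1) (wBAV A V) (2 * r i - 2) (2 * s j - 1) (2 * n - 1)) =
        (-1) ^ (∑ i, (r i + s i)) *
        (∏ i ∈ Finset.Icc (1 : ℤ) (k + m), (A i ^ (-(n : ℤ)) * V i ^ (-(n : ℤ)))) *
        (∏ j, (A (r j) ^ 2 * V (r j) * (A (s j))⁻¹ *
          extProd (r j + 1) (s j + 1) (fun i => A i ^ 2 * V i ^ 2))) *
        Matrix.det (Matrix.of fun i j : Fin m =>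
          pathGF (2 * k + 2 * m - 1) (wBAV A V) (2 * r' i - 2) (2 * s' j - 1) (-2 * n + 1)) ∧
        Matrix.det (Matrix.of fun i j : Fin k =>
          pathGF (2 * k + 2 * m - 1) (wBAV A V) (2 * r i - 2) (2 * s j - 1) (2 * n - 1)) =
        (-1) ^ (∑ i, (r' i + s' i)) *
        (∏ i ∈ Finset.Icc (1 : ℤ) (k + m),
          (A i ^ (-(n : ℤ) + 1) * V i ^ (-(n : ℤ) + 1))) *
        (∏ j, (A (r' j) ^ (-2 : ℤ) * (V (r' j))⁻¹ * A (s' j) *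
          extProd (r' j + 1) (s' j + 1) (fun i => A i ^ (-2 : ℤ) * V i ^ (-2 : ℤ)))) *
        Matrix.det (Matrix.of fun i j : Fin m =>
          pathGF (2 * k + 2 * m - 1) (wBAV A V) (2 * r' i - 2) (2 * s' j - 1) (-2 * n + 1))) := by
  -- The indices run over `1, …, k + m`, the matrix rows and columns over `0, …, k + m - 1`. The
  -- shift by one adds an even number to each sign exponent.
  have lift : ∀ {l : ℕ} (f : Fin l → ℤ), (∀ i, 1 ≤ f i ∧ f i ≤ k + m) →
      ∃ g : Fin l → Fin (k + m), f = fun i => ((g i : ℕ) : ℤ) + 1 := by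
    intro l f hf
    refine ⟨fun i => ⟨(f i - 1).toNat, by have := hf i; omega⟩, funext fun i => ?_⟩
    have := hf i
    simp only
    omega
  have hrb' : ∀ i, 1 ≤ r' i ∧ r' i ≤ k + m := fun i =>
    ((hrr ▸ Set.mem_range_self i : r' i ∈ Set.Icc (1 : ℤ) (k + m) \ Set.range r)).1
  have hsb' : ∀ i, 1 ≤ s' i ∧ s' i ≤ k + m := fun i =>
    ((hss ▸ Set.mem_range_self i : s' i ∈ Set.Icc (1 : ℤ) (k + m) \ Set.range s)).1
  have dr : ∀ i j, r i ≠ r' j := fun i j h =>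
    ((hrr ▸ Set.mem_range_self j : r' j ∈ Set.Icc (1 : ℤ) (k + m) \ Set.range r)).2 ⟨i, h⟩
  have ds : ∀ i j, s i ≠ s' j := fun i j h =>
    ((hss ▸ Set.mem_range_self j : s' j ∈ Set.Icc (1 : ℤ) (k + m) \ Set.range s)).2 ⟨i, h⟩
  clear hrr hss
  obtain ⟨ρ, rfl⟩ := lift r hrb
  obtain ⟨σ, rfl⟩ := lift s hsb
  obtain ⟨ρ', rfl⟩ := lift r' hrb'
  obtain ⟨σ', rfl⟩ := lift s' hsb'
  have mono : ∀ {l : ℕ} {g : Fin l → Fin (k + m)},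
      StrictMono (fun i => ((g i : ℕ) : ℤ) + 1) → StrictMono g := by
    intro l g h i j hij
    have := h hij
    simp only at this
    rw [Fin.lt_def]
    omega
  replace hr := mono hr
  replace hs := mono hs
  replace hr' := mono hr'
  replace hs' := mono hs'
  replace dr : ∀ i j, ρ i ≠ ρ' j := fun i j h => dr i j (by simp only [h])
  replace ds : ∀ i j, σ i ≠ σ' j := fun i j h => ds i j (by simp only [h])
  clear lift hrb hsb hrb' hsb' mono
  have hB := substAV_ne_zero hA hV
  have hN : (2 * k + 2 * m - 1 : ℤ) = 2 * ((k + m : ℕ) : ℤ) - 1 := by push_cast; ring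
  have hN' : (k : ℤ) + m = ((k + m : ℕ) : ℤ) := by push_cast; rfl
  have hw : wBAV A V = wB (substAV A V) := rfl
  have ee : ∀ x : ℤ, 2 * (x + 1) - 2 = 2 * x := fun x => by ring
  have eo : ∀ x : ℤ, 2 * (x + 1) - 1 = 2 * x + 1 := fun x => by ring
  have sign : ∀ {l : ℕ} (f g : Fin l → Fin (k + m)),
      (-1 : K) ^ (∑ i, ((((f i : ℕ) : ℤ) + 1) + (((g i : ℕ) : ℤ) + 1))) =
        (-1) ^ (∑ i, ((f i : ℕ) + g i)) := by
    intro l f g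
    have : ∑ i, ((((f i : ℕ) : ℤ) + 1) + (((g i : ℕ) : ℤ) + 1)) =
        ((∑ i, ((f i : ℕ) + g i) + 2 * l : ℕ) : ℤ) := by
      push_cast
      simp only [Finset.sum_add_distrib, Finset.sum_const, Finset.card_univ, Fintype.card_fin,
        nsmul_eq_mul]
      ring
    rw [this, zpow_natCast, pow_add, pow_mul]
    simp
  have hsign := neg_one_pow_sum_complementary (K := K) hr hs hr' hs' dr ds
  simp only [sign, ee, eo, hN, hN', hw, even_factor hA hV, even_factor' hA hV, odd_factor hA hV,
    odd_factor' hA hV]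
  constructor
  · intro n
    have key := det_even_submatrix hB hr hs hr' hs' dr ds n
    rw [prod_substAV_zpow] at key
    have l1 : ∀ i j, pathGF (2 * ((k + m : ℕ) : ℤ) - 1) (wB (substAV A V)) (2 * (ρ i : ℕ))
        (2 * (σ j : ℕ)) (2 * n) = ((evenOdd (substAV A V) (k + m) *
          oddEven (substAV A V) (k + m)) ^ (n : ℤ)) (ρ i) (σ j) :=
      fun i j => pathGF_even (k + m) hB (ρ i) (σ j) n
    have l2 : ∀ i j, pathGF (2 * ((k + m : ℕ) : ℤ) - 1) (wB (substAV A V)) (2 * (ρ' i : ℕ))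
        (2 * (σ' j : ℕ)) (-2 * n) = ((evenOdd (substAV A V) (k + m) *
          oddEven (substAV A V) (k + m)) ^ (-(n : ℤ))) (ρ' i) (σ' j) := by
      intro i j
      rw [← pathGF_even (k + m) hB, show -2 * (n : ℤ) = 2 * -n by ring]
    simp only [l1, l2]
    rw [← hsign, prod_descent_even_complementary hB hr hs hr' hs' dr ds]
    exact ⟨key, key⟩
  · intro n _
    have key := det_odd_submatrix hB hr hs hr' hs' dr ds ((n : ℤ) - 1)
    have l1 : ∀ i j, pathGF (2 * ((k + m : ℕ) : ℤ) - 1) (wB (substAV A V)) (2 * (ρ i : ℕ))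
        (2 * (σ j : ℕ) + 1) (2 * n - 1) = ((evenOdd (substAV A V) (k + m) *
          oddEven (substAV A V) (k + m)) ^ ((n : ℤ) - 1) *
            evenOdd (substAV A V) (k + m)) (ρ i) (σ j) := by
      intro i j
      rw [← pathGF_odd (k + m) hB, show 2 * ((n : ℤ) - 1) + 1 = 2 * n - 1 by ring]
    have l2 : ∀ i j, pathGF (2 * ((k + m : ℕ) : ℤ) - 1) (wB (substAV A V)) (2 * (ρ' i : ℕ))
        (2 * (σ' j : ℕ) + 1) (-2 * n + 1) = ((evenOdd (substAV A V) (k + m) *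
          oddEven (substAV A V) (k + m)) ^ (-((n : ℤ) - 1) - 1) *
            evenOdd (substAV A V) (k + m)) (ρ' i) (σ' j) := by
      intro i j
      rw [← pathGF_odd (k + m) hB, show 2 * (-((n : ℤ) - 1) - 1) + 1 = -2 * n + 1 by ring]
    -- The length `2n - 1` is `2(n - 1) + 1`, so Jacobi gives the power `n - 1` of the determinant,
    -- as in the second form; exchanging the descent products for those over `r`, `s` supplies the
    -- missing factor of the first form.
    have hprod := prod_descent_odd_complementary hB hr hs hr' hs' dr ds
    have key2 := key
    have hne : ∏ i : Fin (k + m), substAV A V (2 * (i : ℕ) + 1) ≠ 0 :=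
      Finset.prod_ne_zero_iff.2 fun _ _ => hB _
    rw [← hprod, ← mul_assoc (_ * _ ^ _), mul_assoc ((-1) ^ _), ← zpow_add_one₀ hne,
      sub_add_cancel, prod_substAV_zpow] at key
    rw [prod_substAV_zpow] at key2
    have e1 : -(n : ℤ) + 1 = -((n : ℤ) - 1) := by ring
    simp only [l1, l2, ← hsign, e1]
    exact ⟨key, key2⟩

end Statements

/-! ### The area weight -/

section Area

theorem card_squares {y e : ℤ} (hy : 0 ≤ y) (he : y % 2 = e) :
    (Finset.card {b ∈ Finset.Ico 0 y | b % 2 = e ∧ b + 2 ≤ y} : ℤ) = y / 2 := by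
  have : Finset.card {b ∈ Finset.Ico 0 y | b % 2 = e ∧ b + 2 ≤ y} =
      (Finset.range (y / 2).toNat).card := by
    refine Finset.card_bij' (fun b _ => (b / 2).toNat) (fun (t : ℕ) _ => 2 * (t : ℤ) + e)
      ?_ ?_ ?_ ?_ <;> simp only [Finset.mem_filter, Finset.mem_Ico, Finset.mem_range] <;>
      intros <;> omega
  rw [this, Finset.card_range]
  omega

theorem parity_of_mem_upDownPaths {h s : ℤ} {n : ℕ} {p : Fin (n + 1) → ℤ}
    (hp : p ∈ upDownPaths h n 0 s) (x : Fin (n + 1)) : p x % 2 = ((x : ℕ) : ℤ) % 2 := by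
  simp only [upDownPaths, Finset.mem_filter] at hp
  induction x using Fin.induction with
  | zero => rw [hp.2.1]; rfl
  | succ i ih =>
    have := hp.2.2.2 i
    simp only [Fin.val_castSucc, Fin.val_succ] at ih ⊢
    push_cast
    omega

/-- The area is the sum of `p x / 2` over the columns. Up to a difference of the potential `(x / 2)
* ((x - 1) / 2)`, each step contributes `0` if up and `j - 1` if down from `j`; the potential
telescopes away because both ends are at height `0`. -/
theorem area_eq_sum {h : ℤ} {n : ℕ} {p : Fin (n + 1) → ℤ} (hp : p ∈ upDownPaths h n 0 0) :
    (area n p : ℤ) =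
      ∑ i : Fin n, if p i.succ = p i.castSucc - 1 then p i.castSucc - 1 else 0 := by
  have hpar := parity_of_mem_upDownPaths hp
  simp only [upDownPaths, Finset.mem_filter, Fintype.mem_piFinset, Finset.mem_Icc] at hp
  obtain ⟨hb, h0, hl, hstep⟩ := hp
  have h1 : (area n p : ℤ) = ∑ x : Fin (n + 1), p x / 2 := by
    rw [area]
    push_cast
    exact Finset.sum_congr rfl fun x _ => card_squares (hb x).1 (hpar x)
  have potential : ∀ x : ℤ,
      ((x + 1) / 2) * (x / 2) - (x / 2) * ((x - 1) / 2) = x / 2 := by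
    intro x
    rcases Int.even_or_odd' x with ⟨t, rfl | rfl⟩
    · rw [show (2 * t + 1) / 2 = t by omega, show 2 * t / 2 = t by omega,
        show (2 * t - 1) / 2 = t - 1 by omega]
      ring
    · rw [show (2 * t + 1 + 1) / 2 = t + 1 by omega, show (2 * t + 1) / 2 = t by omega,
        show (2 * t + 1 - 1) / 2 = t by omega]
      ring
  have h2 : ∀ i : Fin n, p i.castSucc / 2 =
      (if p i.succ = p i.castSucc - 1 then p i.castSucc - 1 else 0) +
        ((p i.succ / 2) * ((p i.succ - 1) / 2) -
          (p i.castSucc / 2) * ((p i.castSucc - 1) / 2)) := by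
    intro i
    rcases hstep i with h | h
    · rw [if_neg (by omega), h]
      have := potential (p i.castSucc)
      rw [show p i.castSucc + 1 - 1 = p i.castSucc by ring]
      linarith
    · rw [if_pos h, h]
      have := potential (p i.castSucc - 1)
      rw [show p i.castSucc - 1 + 1 = p i.castSucc by ring] at this
      have h3 : p i.castSucc / 2 + (p i.castSucc - 1) / 2 = p i.castSucc - 1 := by omega
      linarith
  have h4 : ∑ i : Fin n, (p i.succ / 2) * ((p i.succ - 1) / 2) =
      ∑ i : Fin n, (p i.castSucc / 2) * ((p i.castSucc - 1) / 2) := by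
    have a := Fin.sum_univ_succ (fun x : Fin (n + 1) => (p x / 2) * ((p x - 1) / 2))
    have b := Fin.sum_univ_castSucc (fun x : Fin (n + 1) => (p x / 2) * ((p x - 1) / 2))
    simp only [h0, hl] at a b
    omega
  rw [h1, Fin.sum_univ_castSucc, hl, Finset.sum_congr rfl fun i _ => h2 i,
    Finset.sum_add_distrib, Finset.sum_sub_distrib, h4]
  simp

variable {K : Type*} [Field K]

theorem prod_zpow_sum {ι : Type*} {q : K} (hq : q ≠ 0) (s : Finset ι) (f : ι → ℤ) :
    ∏ i ∈ s, q ^ f i = q ^ (∑ i ∈ s, f i) := by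
  classical
  induction s using Finset.induction_on with
  | empty => simp
  | insert a s ha ih => rw [Finset.sum_insert ha, Finset.prod_insert ha, zpow_add₀ hq, ih]

theorem wArea_eq_wB {q : K} (hq : q ≠ 0) {h : ℤ} {n : ℕ} {p : Fin (n + 1) → ℤ}
    (hp : p ∈ upDownPaths h n 0 0) : wArea q n p = wB (fun j => q ^ (j - 1)) n p := by
  rw [wArea, wB, ← zpow_natCast, area_eq_sum hp]
  rw [← prod_zpow_sum hq]
  refine Finset.prod_congr rfl fun i _ => ?_
  split_ifs <;> simp

theorem GF_wArea {q : K} (hq : q ≠ 0) (h : ℤ) (n : ℕ) :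
    GF (upDownPaths h n 0 0) (wArea q n) =
      GF (upDownPaths h n 0 0) (wB (fun j => q ^ (j - 1)) n) :=
  Finset.sum_congr rfl fun _ hp => wArea_eq_wB hq hp

theorem pathGF_wArea {q : K} (hq : q ≠ 0) (h : ℤ) :
    pathGF h (wArea q) 0 0 = pathGF h (wB fun j => q ^ (j - 1)) 0 0 := by
  funext z
  cases z with
  | ofNat n => exact GF_wArea hq h n
  | negSucc n =>
    simp only [pathGF, GF_wArea hq]

/-- A path of length `2z` from `0` to `0` has `z` down-steps. For negative `z` this count is
replaced by the conjugation with `D`, which carries the scaled product to `c` times the original one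
and fixes the corner entry. -/
theorem evenOdd_mul_oddEven_zpow_scale {B : ℤ → K} (hB : ∀ j, B j ≠ 0) {c : K} (hc : c ≠ 0)
    (N : ℕ) [NeZero N] (z : ℤ) :
    ((evenOdd (fun j => c * B j) N * oddEven (fun j => c * B j) N) ^ z) 0 0 =
      c ^ z * ((evenOdd B N * oddEven B N) ^ z) 0 0 := by
  let D : Matrix (Fin N) (Fin N) K := Matrix.diagonal fun i => c ^ (-((i : ℕ) : ℤ))
  have hcB : ∀ j, c * B j ≠ 0 := fun j => mul_ne_zero hc (hB j)
  have h1 : D * evenOdd (fun j => c * B j) N = evenOdd B N * D := by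
    ext i j
    rw [Matrix.diagonal_mul, Matrix.mul_diagonal, evenOdd_apply, evenOdd_apply]
    by_cases h : (j : ℕ) = i
    · rw [if_pos h, if_pos h, h]; ring
    · by_cases h' : (j : ℕ) + 1 = i
      · rw [if_neg h, if_pos h', if_neg h, if_pos h', ← h']
        push_cast
        rw [show -(j : ℤ) = -((j : ℤ) + 1) + 1 by ring, zpow_add_one₀ hc]
        ring
      · rw [if_neg h, if_neg h', if_neg h, if_neg h']; ring
  have h2 : D * oddEven (fun j => c * B j) N = (c • oddEven B N) * D := by
    ext i j
    rw [Matrix.diagonal_mul, Matrix.mul_diagonal, Matrix.smul_apply, oddEven_apply, oddEven_apply,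
      smul_eq_mul]
    by_cases h : (j : ℕ) = i + 1
    · rw [if_pos h, if_pos h, h]
      push_cast
      rw [show -(i : ℤ) = -((i : ℤ) + 1) + 1 by ring, zpow_add_one₀ hc]
      ring
    · by_cases h' : (j : ℕ) = i
      · rw [if_neg h, if_pos h', if_neg h, if_pos h', h']
        ring
      · rw [if_neg h, if_neg h', if_neg h, if_neg h']; ring
  have hu := isUnit_det_evenOdd_mul_oddEven N hB
  have hu' := isUnit_det_evenOdd_mul_oddEven N hcB
  have hu2 : IsUnit (c • (evenOdd B N * oddEven B N)).det := by
    rw [Matrix.det_smul]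
    exact ((isUnit_iff_ne_zero.2 hc).pow _).mul hu
  have hs : SemiconjBy D (evenOdd (fun j => c * B j) N * oddEven (fun j => c * B j) N)
      (c • (evenOdd B N * oddEven B N)) := by
    rw [SemiconjBy, ← Matrix.mul_assoc, h1, Matrix.mul_assoc, h2, ← Matrix.mul_assoc,
      Matrix.mul_smul]
  have hz := Matrix.SemiconjBy.zpow_right hu' hu2 hs z
  have hpow : (c • (evenOdd B N * oddEven B N)) ^ z = c ^ z • (evenOdd B N * oddEven B N) ^ z := by
    cases z with
    | ofNat n => simp [smul_pow]
    | negSucc n =>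
      rw [zpow_negSucc, zpow_negSucc, zpow_negSucc, smul_pow]
      refine Matrix.inv_eq_right_inv ?_
      rw [Matrix.smul_mul, Matrix.mul_smul, smul_smul,
        Matrix.mul_nonsing_inv _ (by rw [Matrix.det_pow]; exact hu.pow _),
        mul_inv_cancel₀ (pow_ne_zero _ hc), one_smul]
  rw [hpow] at hz
  have := congrFun (congrFun hz 0) 0
  rw [Matrix.diagonal_mul, Matrix.mul_diagonal] at this
  simpa using this

/-- Covers both weights needed below: `a = 0`, `b = 1` for the area weight and `a = 2(k + m) - 2`,
`b = -1` for its reflection. -/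
theorem descent_zpow {q : K} (hq : q ≠ 0) (a b : ℤ) (i : ℕ) :
    descent (fun j => q ^ (a + b * (j - 1))) (2 * i) = q ^ (2 * a * i + b * (i * (2 * i - 1))) := by
  rw [descent, prod_zpow_sum hq]
  congr 1
  induction i with
  | zero => simp
  | succ i ih =>
    rw [show 2 * (i + 1) = 2 * i + 1 + 1 by ring, Finset.sum_range_succ, Finset.sum_range_succ, ih]
    push_cast
    ring

theorem sum_mul_two_mul_sub_one (k : ℕ) :
    ((∑ i ∈ Finset.range k, ((i : ℤ) * (2 * i - 1)) : ℤ) : ℚ) = k * (k - 1) * (4 * k - 5) / 6 := by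
  push_cast
  induction k with
  | zero => simp
  | succ k ih => rw [Finset.sum_range_succ, ih]; push_cast; ring

theorem sum_range_cast (k : ℕ) :
    ((∑ i ∈ Finset.range k, (i : ℤ) : ℤ) : ℚ) = k * (k - 1) / 2 := by
  push_cast
  induction k with
  | zero => simp
  | succ k ih => rw [Finset.sum_range_succ, ih]; push_cast; ring

theorem hankel_wArea_reciprocity {q : K} (hq : q ≠ 0) (n k m : ℕ) : ∃ e : ℤ,
    (e : ℚ) = 2 * (k.choose 2 : ℚ) * ((4 * k + 1) / 6 + n + 2 * m - 2) -
      2 * (m.choose 2 : ℚ) * (n - 1 + (8 * m - 1) / 6) ∧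
    Matrix.det (Matrix.of fun i j : Fin k =>
      pathGF (2 * k + 2 * m - 1) (wArea q) 0 0 (2 * n + 2 * i + 2 * j + 4 * m - 2)) =
    q ^ e *
    Matrix.det (Matrix.of fun i j : Fin m =>
      pathGF (2 * k + 2 * m - 1) (wArea q⁻¹) 0 0 (-2 * n - 2 * i - 2 * j)) := by
  rcases Nat.eq_zero_or_pos (k + m) with h0 | h0
  · obtain ⟨rfl, rfl⟩ : k = 0 ∧ m = 0 := by omega
    exact ⟨0, by simp, by simp⟩
  have : NeZero (k + m) := ⟨h0.ne'⟩
  have hq' : q⁻¹ ≠ 0 := inv_ne_zero hq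
  have hB : ∀ j : ℤ, q ^ (j - 1) ≠ 0 := fun j => zpow_ne_zero _ hq
  have hB' : ∀ j : ℤ, q⁻¹ ^ (j - 1) ≠ 0 := fun j => zpow_ne_zero _ hq'
  have h := hankel_pathGF_eq hB n k m
  have hc : q ^ (2 * ((k + m : ℕ) : ℤ) - 2) ≠ 0 := zpow_ne_zero _ hq
  have hN : (2 * k + 2 * m - 1 : ℤ) = 2 * ((k + m : ℕ) : ℤ) - 1 := by push_cast; ring
  have e2 : ∀ i j : ℕ, (-2 * n - 2 * i - 2 * j : ℤ) = 2 * (-(n : ℤ) - i - j) := fun i j => by ring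
  have hrefl : (fun j : ℤ => q ^ (2 * ((k + m : ℕ) : ℤ) - j - 1)) =
      fun j => q ^ (2 * ((k + m : ℕ) : ℤ) - 2) * q⁻¹ ^ (j - 1) := by
    funext j
    rw [inv_zpow', ← zpow_add₀ hq]
    congr 1
    ring
  have hscale : (Matrix.of fun i j : Fin m =>
        pathGF (2 * k + 2 * m - 1) (wB fun j => q ^ (2 * ((k + m : ℕ) : ℤ) - j - 1)) 0 0
          (-2 * n - 2 * i - 2 * j)).det =
      q ^ ((2 * ((k + m : ℕ) : ℤ) - 2) * (-(n * m) - 2 * ∑ i ∈ Finset.range m, (i : ℤ))) *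
      (Matrix.of fun i j : Fin m =>
        pathGF (2 * k + 2 * m - 1) (wArea q⁻¹) 0 0 (-2 * n - 2 * i - 2 * j)).det := by
    have hentry : (Matrix.of fun i j : Fin m =>
        pathGF (2 * k + 2 * m - 1) (wB fun j => q ^ (2 * ((k + m : ℕ) : ℤ) - j - 1)) 0 0
          (-2 * n - 2 * i - 2 * j)) =
        -- The scaling factor of an entry has exponent `-n - i - j`, so it splits into a row factor
        -- and a column factor that leave the determinant.
        Matrix.of fun i j : Fin m =>
          (q ^ (2 * ((k + m : ℕ) : ℤ) - 2)) ^ (-(n : ℤ) - (i : ℕ)) *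
          (Matrix.of fun i j : Fin m => (q ^ (2 * ((k + m : ℕ) : ℤ) - 2)) ^ (-((j : ℕ) : ℤ)) *
            (Matrix.of fun i j : Fin m =>
        pathGF (2 * k + 2 * m - 1) (wArea q⁻¹) 0 0 (-2 * n - 2 * i - 2 * j)) i j) i j := by
      ext i j
      simp only [Matrix.of_apply, hN, e2]
      rw [pathGF_wArea hq', pathGF_zero_zero hB', hrefl,
        pathGF_zero_zero (fun j => mul_ne_zero hc (hB' j)),
        evenOdd_mul_oddEven_zpow_scale hB' hc, ← mul_assoc, ← zpow_add₀ hc, ← sub_eq_add_neg]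
    rw [hentry, Matrix.det_mul_column, Matrix.det_mul_row, ← mul_assoc]
    congr 1
    rw [prod_zpow_sum hc, prod_zpow_sum hc, ← zpow_add₀ hc, ← zpow_mul]
    congr 2
    simp only [Finset.sum_sub_distrib, Finset.sum_neg_distrib, Finset.sum_const, Finset.card_univ,
      Fintype.card_fin, Finset.sum_range, nsmul_eq_mul]
    ring
  have d1 : ∏ i : Fin k, descent (fun j : ℤ => q ^ (j - 1)) (2 * i) =
      q ^ (∑ i ∈ Finset.range k, ((i : ℤ) * (2 * i - 1))) := by
    have := fun i => descent_zpow hq 0 1 i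
    simp only [zero_add, one_mul, mul_zero, zero_mul] at this
    simp only [this]
    rw [prod_zpow_sum hq, Finset.sum_range]
  have d2 : ∏ i : Fin m, descent (fun j : ℤ => q ^ (2 * ((k + m : ℕ) : ℤ) - j - 1)) (2 * i) =
      q ^ (2 * (2 * ((k + m : ℕ) : ℤ) - 2) * (∑ i ∈ Finset.range m, (i : ℤ)) -
        ∑ i ∈ Finset.range m, ((i : ℤ) * (2 * i - 1))) := by
    have e : (fun j : ℤ => q ^ (2 * ((k + m : ℕ) : ℤ) - j - 1)) =
        fun j : ℤ => q ^ ((2 * ((k + m : ℕ) : ℤ) - 2) + (-1) * (j - 1)) := by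
      funext j
      congr 1
      ring
    simp only [e, descent_zpow hq]
    rw [prod_zpow_sum hq, Finset.sum_range, Finset.sum_range, Finset.mul_sum,
      ← Finset.sum_sub_distrib]
    congr 1
    exact Finset.sum_congr rfl fun i _ => by ring
  have d3 : ∏ j : Fin m, q ^ (2 * ((k + j : ℕ) : ℤ) + 1 - 1) =
      q ^ (2 * k * m + 2 * ∑ i ∈ Finset.range m, (i : ℤ)) := by
    rw [prod_zpow_sum hq, Finset.sum_range, Finset.mul_sum]
    congr 1
    rw [show (2 * k * m : ℤ) = ∑ i : Fin m, (2 * k : ℤ) by simp; ring, ← Finset.sum_add_distrib]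
    exact Finset.sum_congr rfl fun i _ => by push_cast; ring
  have d4 : ∏ i : Fin (k + m), q ^ (2 * ((i : ℕ) : ℤ) + 1 - 1) =
      q ^ (2 * ∑ i ∈ Finset.range (k + m), (i : ℤ)) := by
    rw [prod_zpow_sum hq, Finset.sum_range, Finset.mul_sum]
    congr 1
    exact Finset.sum_congr rfl fun i _ => by ring
  rw [hscale, d1, d2, d3, d4, ← zpow_add₀ hq, ← zpow_mul, ← zpow_add₀ hq, ← mul_assoc,
    ← zpow_add₀ hq] at h
  rw [pathGF_wArea hq]
  have cancel : ∀ (a b : ℤ) (x y : K), x * q ^ a = q ^ b * y → x = q ^ (b - a) * y := by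
    intro a b x y hxy
    refine mul_right_cancel₀ (zpow_ne_zero a hq) (hxy.trans ?_)
    rw [mul_right_comm, ← zpow_add₀ hq, sub_add_cancel]
  -- The integer `e` is read off from the collected powers of `q` in `h`. It is compared with the
  -- closed form in `ℚ`, where the divisions by `6` and `2` are exact.
  refine ⟨_, ?_, cancel _ _ _ _ h⟩
  have s1 := sum_mul_two_mul_sub_one k
  have s2 := sum_mul_two_mul_sub_one m
  have s3 := sum_range_cast m
  have s4 := sum_range_cast (k + m)
  generalize ∑ i ∈ Finset.range k, ((i : ℤ) * (2 * i - 1)) = S₁ at s1 ⊢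
  generalize ∑ i ∈ Finset.range m, ((i : ℤ) * (2 * i - 1)) = S₂ at s2 ⊢
  generalize ∑ i ∈ Finset.range m, (i : ℤ) = S₃ at s3 ⊢
  generalize ∑ i ∈ Finset.range (k + m), (i : ℤ) = S₄ at s4 ⊢
  push_cast at s4 ⊢
  rw [s1, s2, s3, s4, Nat.cast_choose_two, Nat.cast_choose_two]
  ring

end Area

end PathReciprocity

theorem theorem34 {K : Type*} [Field K] (A V : ℤ → K)
    (hA : ∀ i, A i ≠ 0) (hV : ∀ i, V i ≠ 0) :
    -- the generating functions for negative lengths are well-defined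
    (∀ (N : ℕ) (r s : ℤ), ∃! f : ℤ → K, PathReciprocity.IsRecurrenceExtension
      (fun n : ℕ => PathReciprocity.GF (PathReciprocity.upDownPaths (2 * N - 1) n r s)
        (PathReciprocity.wBAV A V n)) f) ∧
    -- paths from height 0 to height 0
    (∀ n k m : ℕ,
      Matrix.det (Matrix.of fun i j : Fin k =>
        PathReciprocity.pathGF (2 * k + 2 * m - 1) (PathReciprocity.wBAV A V) 0 0
          (2 * n + 2 * i + 2 * j + 4 * m - 2)) =
      (V 1 ^ k * (A (k + m)) ^ (-(m : ℤ)) *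
        ∏ i ∈ Finset.Icc (1 : ℤ) (k + m),
          (A i ^ (-((n : ℤ) + 2 * m + 2 * k - 2 * i - 1)) *
            V i ^ (-((n : ℤ) + 2 * m + 2 * k - 2 * i)))) *
      Matrix.det (Matrix.of fun i j : Fin m =>
        PathReciprocity.RAV (k + m) (fun A' V' =>
          PathReciprocity.pathGF (2 * k + 2 * m - 1) (PathReciprocity.wBAV A' V') 0 0
            (-2 * n - 2 * i - 2 * j)) A V)) ∧
    -- paths from height 0 to the maximal height
    (∀ n k m : ℕ, 0 < k → 0 < m →
      Matrix.det (Matrix.of fun i j : Fin k =>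
        PathReciprocity.topGF (2 * k + 2 * m - 1) (PathReciprocity.wBAV A V)
          (2 * n + 2 * j - 2 * i)) =
      (-1) ^ (k * m) *
      (∏ i ∈ Finset.Icc (1 : ℤ) (k + m),
        (A i ^ (-(n : ℤ) - m) * V i ^ (-(n : ℤ) - m))) *
      Matrix.det (Matrix.of fun i j : Fin m =>
        PathReciprocity.RAV (k + m) (fun A' V' =>
          PathReciprocity.topGF (2 * k + 2 * m - 1) (PathReciprocity.wBAV A' V')
            (-2 * n - 2 * j + 2 * i - 2 * k - 2 * m)) A V)) ∧
    -- paths of even or odd length with prescribed starting and ending heights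
    (∀ (k m : ℕ) (r s : Fin k → ℤ) (r' s' : Fin m → ℤ), 0 < k → 0 < m →
      StrictMono r → StrictMono s →
      (∀ i, 1 ≤ r i ∧ r i ≤ k + m) → (∀ i, 1 ≤ s i ∧ s i ≤ k + m) →
      StrictMono r' → StrictMono s' →
      Set.range r' = Set.Icc (1 : ℤ) (k + m) \ Set.range r →
      Set.range s' = Set.Icc (1 : ℤ) (k + m) \ Set.range s →
      (∀ n : ℕ,
        Matrix.det (Matrix.of fun i j : Fin k =>
          PathReciprocity.pathGF (2 * k + 2 * m - 1) (PathReciprocity.wBAV A V)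
            (2 * r i - 2) (2 * s j - 2) (2 * n)) =
        (-1) ^ (∑ i, (r i + s i)) *
        (∏ i ∈ Finset.Icc (1 : ℤ) (k + m), (A i ^ (-(n : ℤ)) * V i ^ (-(n : ℤ)))) *
        (∏ j, (V (s j) * (V (r j))⁻¹ *
          PathReciprocity.extProd (r j) (s j) (fun i => A i ^ 2 * V i ^ 2))) *
        Matrix.det (Matrix.of fun i j : Fin m =>
          PathReciprocity.pathGF (2 * k + 2 * m - 1) (PathReciprocity.wBAV A V)
            (2 * r' i - 2) (2 * s' j - 2) (-2 * n)) ∧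
        Matrix.det (Matrix.of fun i j : Fin k =>
          PathReciprocity.pathGF (2 * k + 2 * m - 1) (PathReciprocity.wBAV A V)
            (2 * r i - 2) (2 * s j - 2) (2 * n)) =
        (-1) ^ (∑ i, (r' i + s' i)) *
        (∏ i ∈ Finset.Icc (1 : ℤ) (k + m), (A i ^ (-(n : ℤ)) * V i ^ (-(n : ℤ)))) *
        (∏ j, (V (r' j) * (V (s' j))⁻¹ *
          PathReciprocity.extProd (r' j) (s' j)
            (fun i => A i ^ (-2 : ℤ) * V i ^ (-2 : ℤ)))) *
        Matrix.det (Matrix.of fun i j : Fin m =>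
          PathReciprocity.pathGF (2 * k + 2 * m - 1) (PathReciprocity.wBAV A V)
            (2 * r' i - 2) (2 * s' j - 2) (-2 * n))) ∧
      (∀ n : ℕ, 0 < n →
        Matrix.det (Matrix.of fun i j : Fin k =>
          PathReciprocity.pathGF (2 * k + 2 * m - 1) (PathReciprocity.wBAV A V)
            (2 * r i - 2) (2 * s j - 1) (2 * n - 1)) =
        (-1) ^ (∑ i, (r i + s i)) *
        (∏ i ∈ Finset.Icc (1 : ℤ) (k + m), (A i ^ (-(n : ℤ)) * V i ^ (-(n : ℤ)))) *
        (∏ j, (A (r j) ^ 2 * V (r j) * (A (s j))⁻¹ *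
          PathReciprocity.extProd (r j + 1) (s j + 1) (fun i => A i ^ 2 * V i ^ 2))) *
        Matrix.det (Matrix.of fun i j : Fin m =>
          PathReciprocity.pathGF (2 * k + 2 * m - 1) (PathReciprocity.wBAV A V)
            (2 * r' i - 2) (2 * s' j - 1) (-2 * n + 1)) ∧
        Matrix.det (Matrix.of fun i j : Fin k =>
          PathReciprocity.pathGF (2 * k + 2 * m - 1) (PathReciprocity.wBAV A V)
            (2 * r i - 2) (2 * s j - 1) (2 * n - 1)) =
        (-1) ^ (∑ i, (r' i + s' i)) *
        (∏ i ∈ Finset.Icc (1 : ℤ) (k + m),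
          (A i ^ (-(n : ℤ) + 1) * V i ^ (-(n : ℤ) + 1))) *
        (∏ j, (A (r' j) ^ (-2 : ℤ) * (V (r' j))⁻¹ * A (s' j) *
          PathReciprocity.extProd (r' j + 1) (s' j + 1)
            (fun i => A i ^ (-2 : ℤ) * V i ^ (-2 : ℤ)))) *
        Matrix.det (Matrix.of fun i j : Fin m =>
          PathReciprocity.pathGF (2 * k + 2 * m - 1) (PathReciprocity.wBAV A V)
            (2 * r' i - 2) (2 * s' j - 1) (-2 * n + 1)))) ∧
    -- the area weight
    (∀ q : K, q ≠ 0 →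
      (∀ N : ℕ, ∃! f : ℤ → K, PathReciprocity.IsRecurrenceExtension
        (fun n : ℕ => PathReciprocity.GF (PathReciprocity.upDownPaths (2 * N - 1) n 0 0)
          (PathReciprocity.wArea q n)) f) ∧
      ∀ n k m : ℕ, ∃ e : ℤ,
        (e : ℚ) = 2 * (k.choose 2 : ℚ) * ((4 * k + 1) / 6 + n + 2 * m - 2) -
          2 * (m.choose 2 : ℚ) * (n - 1 + (8 * m - 1) / 6) ∧
        Matrix.det (Matrix.of fun i j : Fin k =>
          PathReciprocity.pathGF (2 * k + 2 * m - 1) (PathReciprocity.wArea q) 0 0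
            (2 * n + 2 * i + 2 * j + 4 * m - 2)) =
        q ^ e *
        Matrix.det (Matrix.of fun i j : Fin m =>
          PathReciprocity.pathGF (2 * k + 2 * m - 1) (PathReciprocity.wArea q⁻¹) 0 0
            (-2 * n - 2 * i - 2 * j))) := by
  refine ⟨fun N r s => ?_, PathReciprocity.hankel_substAV_reciprocity hA hV,
    fun n k m hk _ => PathReciprocity.toeplitz_substAV_reciprocity hA hV n k m hk,
    fun k m r s r' s' _ _ hr hs hrb hsb hr' hs' hrr hss =>
      PathReciprocity.minors_substAV_reciprocity hA hV k m r s r' s' hr hs hrb hsb hr' hs' hrr hss,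
    fun q hq => ⟨fun N => ?_, fun n k m => PathReciprocity.hankel_wArea_reciprocity hq n k m⟩⟩
  · exact PathReciprocity.existsUnique_isRecurrenceExtension N
      (PathReciprocity.substAV_ne_zero hA hV) r s
  · simp only [PathReciprocity.GF_wArea hq]
    exact PathReciprocity.existsUnique_isRecurrenceExtension N (fun _ => zpow_ne_zero _ hq) 0 0
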